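/- Let $\Lambda$ be a left and right noetherian ring and $k$ a positive integer. Write $\operatorname{mod}\Lambda$ for the category of finitely generated left $\Lambda$-modules and $\mathcal P^{n}(\Lambda)$ for its full subcategory of modules of projective dimension at most $n$. Conventions. For $M\in\operatorname{mod}\Lambda$, the group $\operatorname{Ext}^i_\Lambda(M,\Lambda)$ is a right $\Lambda$-module via right multiplication on $\Lambda$. A right $\Lambda$-module $X$ has grade at least $i$ if $\operatorname{Ext}^j_{\Lambda^{op}}(X,\Lambda)=0$ for $0\le j<i$; a right module $N$ satisfies $\operatorname{s.grade}N\ge i$ if every submodule of $N$ has grade at least $i$. The ring $\Lambda$ has property $(\mathrm W^{n})$ if every $M\in\operatorname{mod}\Lambda$ with $\operatorname{Ext}^i_\Lambda(M,\Lambda)=0$ for $1\le i\le n$ is torsionless, i.e. the evaluation map $M\to M^{**}$ is injective, where $(-)^*=\operatorname{Hom}(-,\Lambda)$. The ring $\Lambda$ is right quasi $k$-Gorenstein if, in a minimal injective resolution $0\to\Lambda\to I_0\to I_1\to\cdots$ of $\Lambda$ as a right $\Lambda$-module, the flat dimension of $I_i$ is at most $i+1$ for $0\le i\le k-1$. For a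 full subcategory $\mathcal D\subseteq\operatorname{mod}\Lambda$, let $\operatorname{add}\mathcal D$ consist of the modules isomorphic to direct summands of finite direct sums of modules in $\mathcal D$. A left $\mathcal D$-approximation of $M$ is a homomorphism $M\to D$ with $D\in\operatorname{add}\mathcal D$ such that $\operatorname{Hom}_\Lambda(D,X)\to\operatorname{Hom}_\Lambda(M,X)$ is surjective for all $X\in\operatorname{add}\mathcal D$; $\mathcal D$ is covariantly finite in $\operatorname{mod}\Lambda$ if every module in $\operatorname{mod}\Lambda$ has a left $\mathcal D$-approximation. **Proposition 3.7.** Let $M\in\operatorname{mod}\Lambda$ satisfy $\operatorname{s.grade}\operatorname{Ext}^{t+1}_\Lambda(M,\Lambda)\ge t$ for all $1\le t\le k-1$. If $\Lambda$ has property $(\mathrm W^{k})$, then $M$ has a left $\mathcal P^{k}(\Lambda)$-approximation. **Corollary 3.8.** Let $\Lambda$ be right quasi $k$-Gorenstein. 1. If $\Lambda$ has property $(\mathrm W^{k})$, then $\mathcal P^{k}(\Lambda)$ is covariantly finite in $\operatorname{mod}\Lambda$. 2. If $\Lambda$ has property $(\mathrm W^{k+1})$, then $\mathcal P^{k+1}(\Lambda)$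 is covariantly finite in $\operatorname{mod}\Lambda$. -/

import Mathlib

open CategoryTheory MulOpposite
open scoped TensorProduct

universe u

noncomputable section

namespace HomologicalFiniteness

/-! Left `Λ`-modules are objects of `ModuleCat Λ`; right `Λ`-modules are objects of
`ModuleCat Λᵐᵒᵖ`. The right module `Λ` is `Λ` with `op r • x = x * r`. -/

section LeftModules

variable (Λ : Type u) [Ring Λ]

/-- `mod Λ`: the finitely generated left `Λ`-modules. -/
def finMod : ObjectProperty (ModuleCat.{u} Λ) := fun M => Module.Finite Λ M

/-- `𝒫ᵏ(Λ)`: the finitely generated left `Λ`-modules of projective dimension at most `k`. -/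
def projDimLE (k : ℕ) : ObjectProperty (ModuleCat.{u} Λ) := fun M =>
  Module.Finite Λ M ∧ HasProjectiveDimensionLE M k

variable {Λ}

/-- Right multiplication by `r`, as an endomorphism of the left module `Λ`. -/
def rightMul (r : Λ) : ModuleCat.of Λ Λ ⟶ ModuleCat.of Λ Λ :=
  ModuleCat.ofHom (LinearMap.toSpanSingleton Λ Λ r)

/-- The right `Λ`-module structure on `Extⁱ_Λ(M, Λ)`: `r` acts by functoriality in the second
variable, through right multiplication by `r` on `Λ`. -/
abbrev extModule (M : ModuleCat.{u} Λ) (i : ℕ) :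
    Module Λᵐᵒᵖ (Abelian.Ext.{u} M (ModuleCat.of Λ Λ) i) where
  smul r x := x.comp (Abelian.Ext.mk₀ (rightMul r.unop)) (add_zero i)
  one_smul x := by
    change x.comp (Abelian.Ext.mk₀ (rightMul (1 : Λ))) (add_zero i) = x
    have h : rightMul (1 : Λ) = 𝟙 _ := by
      ext
      simp [rightMul]
    rw [h]
    exact Abelian.Ext.comp_mk₀_id x
  mul_smul r s x := by
    change x.comp (Abelian.Ext.mk₀ (rightMul (r * s).unop)) (add_zero i) =
      (x.comp (Abelian.Ext.mk₀ (rightMul s.unop)) (add_zero i)).comp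
        (Abelian.Ext.mk₀ (rightMul r.unop)) (add_zero i)
    have h : rightMul (r * s).unop = rightMul s.unop ≫ rightMul r.unop := by
      ext
      simp [rightMul]
    rw [h, Abelian.Ext.comp_assoc_of_third_deg_zero, Abelian.Ext.mk₀_comp_mk₀]
  smul_zero r := Abelian.Ext.zero_comp M i _ i (add_zero i)
  smul_add r x y := Abelian.Ext.add_comp _ _ _ (add_zero i)
  zero_smul x := by
    change x.comp (Abelian.Ext.mk₀ (rightMul (0 : Λ))) (add_zero i) = 0
    have h : rightMul (0 : Λ) = 0 := by
      ext
      simp [rightMul]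
    rw [h, Abelian.Ext.mk₀_zero, Abelian.Ext.comp_zero]
  add_smul r s x := by
    change x.comp (Abelian.Ext.mk₀ (rightMul (r + s).unop)) (add_zero i) =
      x.comp (Abelian.Ext.mk₀ (rightMul r.unop)) (add_zero i) +
      x.comp (Abelian.Ext.mk₀ (rightMul s.unop)) (add_zero i)
    have h : rightMul (r + s).unop = rightMul r.unop + rightMul s.unop := by
      ext
      simp [rightMul]
    rw [h, Abelian.Ext.mk₀_add, Abelian.Ext.comp_add]

/-- `Extⁱ_Λ(M, Λ)`, as a type of its own that carries the right `Λ`-module structure. -/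
def ExtRing (M : ModuleCat.{u} Λ) (i : ℕ) : Type u :=
  Abelian.Ext.{u} M (ModuleCat.of Λ Λ) i

instance (M : ModuleCat.{u} Λ) (i : ℕ) : AddCommGroup (ExtRing M i) :=
  inferInstanceAs (AddCommGroup (Abelian.Ext.{u} M (ModuleCat.of Λ Λ) i))

instance (M : ModuleCat.{u} Λ) (i : ℕ) : Module Λᵐᵒᵖ (ExtRing M i) :=
  extModule M i

/-- `M` is a `Wᵏ`-module: `Extⁱ_Λ(M, Λ) = 0` for `1 ≤ i ≤ k`. -/
def IsWModule (k : ℕ) (M : ModuleCat.{u} Λ) : Prop :=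
  ∀ i : ℕ, 1 ≤ i → i ≤ k → Subsingleton (ExtRing M i)

/-- The evaluation map `σ_A : A → A**`, `σ_A(x)(f) = f(x)`, where `A* = Hom_Λ(A, Λ)` is a right
`Λ`-module through the right multiplication of `Λ`. -/
def evalBidual (A : ModuleCat.{u} Λ) : A →ₗ[Λ] ((A →ₗ[Λ] Λ) →ₗ[Λᵐᵒᵖ] Λ) where
  toFun x :=
    { toFun := fun f => f x
      map_add' := fun _ _ => rfl
      map_smul' := fun _ _ => rfl }
  map_add' x y := by
    ext f
    exact f.map_add x y
  map_smul' r x := by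
    ext f
    exact f.map_smul r x

/-- `A` is torsionless: `σ_A` is a monomorphism. -/
def IsTorsionless (A : ModuleCat.{u} Λ) : Prop := Function.Injective (evalBidual A)

variable (Λ) in
/-- Property `(Wᵏ)`: each `Wᵏ`-module in `mod Λ` is torsionless. -/
def HasPropertyW (k : ℕ) : Prop :=
  ∀ M : ModuleCat.{u} Λ, finMod Λ M → IsWModule k M → IsTorsionless M

/-- `add 𝒟`: the modules isomorphic to direct summands of finite direct sums of modules
in `𝒟`. -/
def addClosure (D : ObjectProperty (ModuleCat.{u} Λ)) : ObjectProperty (ModuleCat.{u} Λ) :=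
  fun X => ∃ (Z : ModuleCat.{u} Λ) (n : ℕ) (Y : Fin n → ModuleCat.{u} Λ),
    (∀ i, D (Y i)) ∧ Nonempty ((X × Z) ≃ₗ[Λ] (∀ i, Y i))

/-- `f : M → F` is a left `𝒟`-approximation of `M`: `F ∈ add 𝒟`, and
`Hom(F, X) → Hom(M, X) → 0` is exact for all `X ∈ add 𝒟`. -/
def IsLeftApproximation (D : ObjectProperty (ModuleCat.{u} Λ)) {M F : ModuleCat.{u} Λ}
    (f : M ⟶ F) : Prop :=
  addClosure D F ∧ ∀ X : ModuleCat.{u} Λ, addClosure D X →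
    Function.Surjective (fun h : F ⟶ X => f ≫ h)

/-- `M` has a left `𝒟`-approximation. -/
def HasLeftApproximation (D : ObjectProperty (ModuleCat.{u} Λ)) (M : ModuleCat.{u} Λ) : Prop :=
  ∃ (F : ModuleCat.{u} Λ) (f : M ⟶ F), IsLeftApproximation D f

/-- The full subcategory `𝒟` of `𝒞` is covariantly finite in `𝒞`. -/
def IsCovariantlyFinite (D C : ObjectProperty (ModuleCat.{u} Λ)) : Prop :=
  D ≤ C ∧ ∀ M : ModuleCat.{u} Λ, C M → HasLeftApproximation D M

end LeftModules

section RightModules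

variable {Λ : Type u} [Ring Λ]

/-- The grade of the right module `N` is at least `i`: `Extʲ(N, Λ) = 0` for `0 ≤ j < i`. -/
def GradeGE (i : ℕ) (N : ModuleCat.{u} Λᵐᵒᵖ) : Prop :=
  ∀ j : ℕ, j < i → Subsingleton (Abelian.Ext.{u} N (ModuleCat.of Λᵐᵒᵖ Λ) j)

/-- The strong grade of the right module `N` is at least `i`: every submodule has grade at
least `i`. -/
def StrongGradeGE (i : ℕ) (N : ModuleCat.{u} Λᵐᵒᵖ) : Prop :=
  ∀ X : Submodule Λᵐᵒᵖ N, GradeGE i (ModuleCat.of Λᵐᵒᵖ X)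

/-- The relations `n r ⊗ m = n ⊗ r m` in `N ⊗_ℤ M`, for a right module `N` and a left
module `M`. -/
def tensorRel (N : ModuleCat.{u} Λᵐᵒᵖ) (M : ModuleCat.{u} Λ) : AddSubgroup (N ⊗[ℤ] M) :=
  AddSubgroup.closure
    {x | ∃ (n : N) (r : Λ) (m : M), x = (op r • n) ⊗ₜ[ℤ] m - n ⊗ₜ[ℤ] (r • m)}

/-- The map `N ⊗_Λ M → N ⊗_Λ M'` induced by `f : M → M'`, where `N ⊗_Λ M` is the quotient of
`N ⊗_ℤ M` by the relations `n r ⊗ m = n ⊗ r m`. -/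
def tensorMap (N : ModuleCat.{u} Λᵐᵒᵖ) {M M' : ModuleCat.{u} Λ} (f : M →ₗ[Λ] M') :
    ((N ⊗[ℤ] M) ⧸ tensorRel N M) →+ ((N ⊗[ℤ] M') ⧸ tensorRel N M') :=
  QuotientAddGroup.map _ _ (LinearMap.lTensor N (f.restrictScalars ℤ)).toAddMonoidHom (by
    refine (AddSubgroup.closure_le _).2 ?_
    rintro _ ⟨n, r, m, rfl⟩
    refine AddSubgroup.subset_closure ⟨n, r, f m, ?_⟩
    rw [map_sub]
    simp)

/-- The right `Λ`-module `N` is flat: `N ⊗_Λ -` preserves injections of left modules. -/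
def IsFlatRight (N : ModuleCat.{u} Λᵐᵒᵖ) : Prop :=
  ∀ (M M' : ModuleCat.{u} Λ) (f : M →ₗ[Λ] M'), Function.Injective f →
    Function.Injective (tensorMap N f)

/-- The right `Λ`-module `N` has flat dimension at most `n`: there is an exact sequence
`0 → Fₙ → ⋯ → F₀ → N → 0` with all `Fᵢ` flat (built from its short exact pieces). -/
def FlatDimLE : ℕ → ModuleCat.{u} Λᵐᵒᵖ → Prop
  | 0, N => IsFlatRight N
  | n + 1, N => ∃ (K F : ModuleCat.{u} Λᵐᵒᵖ) (i : K →ₗ[Λᵐᵒᵖ] F) (p : F →ₗ[Λᵐᵒᵖ] N),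
      Function.Injective i ∧ Function.Exact i p ∧ Function.Surjective p ∧
      IsFlatRight F ∧ FlatDimLE n K

/-- The injective resolution `0 → N → I₀ → I₁ → ⋯` is minimal: for every `n`, the submodule
`Ker(Iₙ → Iₙ₊₁)` (the `n`-th cosyzygy; for `n = 0` it is the image of `N`) is essential in `Iₙ`,
so that `Iₙ` is its injective envelope. -/
def IsMinimalResolution {N : ModuleCat.{u} Λᵐᵒᵖ} (I : InjectiveResolution N) : Prop :=
  ∀ (n : ℕ) (X : Submodule Λᵐᵒᵖ (I.cocomplex.X n)),
    X ⊓ LinearMap.ker (I.cocomplex.d n (n + 1)).hom = ⊥ → X = ⊥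

variable (Λ) in
/-- `Λ` is right quasi `k`-Gorenstein: in the minimal injective resolution
`0 → Λ → I₀ → I₁ → ⋯` of the right module `Λ` (unique up to isomorphism), the flat dimension of
`Iᵢ` is at most `i + 1` for `0 ≤ i ≤ k - 1`. -/
def IsRightQuasiGorenstein (k : ℕ) : Prop :=
  ∃ I : InjectiveResolution (ModuleCat.of Λᵐᵒᵖ Λ), IsMinimalResolution I ∧
    ∀ i : ℕ, i < k → FlatDimLE (i + 1) (I.cocomplex.X i)

end RightModules

end HomologicalFiniteness

end

noncomputable section

namespace HomologicalFiniteness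

open Abelian

/-! ### Free modules: resolutions by finite powers, row and column vectors, transposes. -/

section FreeModules

/-! Everything rests on an exact sequence 0 → K → X → M → 0 with pd K < k and Extⁱ(X, Λ) = 0 for 1 ≤
i ≤ k (`exists_isWModule_cover`). Property (Wᵏ) makes X torsionless, so X embeds in some Λᵐ to which
every functional on X extends. The cokernel Y then has Extˡ(Y, Λ) = 0 for 1 ≤ l ≤ k + 1, hence
Ext¹(Y, Z) = 0 for every finitely generated Z with pd Z ≤ k, and every X → Z extends to Λᵐ. The
module F = Λᵐ/K has pd F ≤ k, and M = X/K → F is the approximation: a map M → Z, pulled back to X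
and extended to Λᵐ, still kills K (`hasLeftApproximation_of_gradeGE`).

The cover is built one degree at a time. Suppose Extⁱ(X, Λ) = 0 for 1 ≤ i ≤ n and E = Extⁿ⁺¹(X, Λ)
has grade at least n. Dualize a resolution P of E by finite free right modules. The grade makes P*
exact below degree n, so the cokernel Q of Pₙ₋₁* → Pₙ* has pd Q ≤ n and Extⁱ(Q, Λ) = 0 for 1 ≤ i <
n. Dimension shifting turns the generators of E into a class ξ ∈ Ext¹(X, Q) whose product Extⁿ(Q, Λ)
→ E is bijective (merely onto if n = 0). The extension of X by Q with class ξ then has no Extⁱ into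
Λ for 1 ≤ i ≤ n + 1.

Over a right quasi k-Gorenstein ring the grades come from Tor. For I injective, Hom(Extᵗ⁺¹(M, Λ), I)
is Tor in degree t + 1 of I and M, which vanishes when I has flat dimension at most t. The terms I₀,
…, Iₜ₋₁ qualify for all t ≤ k, which is enough for both k and k + 1
(`IsRightQuasiGorenstein.gradeGE`). -/

theorem exists_comp_eq_of_ker_le {R : Type*} [Ring R] {A B C : Type*} [AddCommGroup A]
    [AddCommGroup B] [AddCommGroup C] [Module R A] [Module R B] [Module R C]
    {p : A →ₗ[R] B} (hp : Function.Surjective p) (f : A →ₗ[R] C)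
    (h : LinearMap.ker p ≤ LinearMap.ker f) : ∃ g : B →ₗ[R] C, g ∘ₗ p = f := by
  refine ⟨(LinearMap.ker p).liftQ f h ∘ₗ (p.quotKerEquivOfSurjective hp).symm.toLinearMap, ?_⟩
  ext a
  have : (p.quotKerEquivOfSurjective hp).symm (p a) = (LinearMap.ker p).mkQ a := by
    rw [LinearEquiv.symm_apply_eq]
    rfl
  simp [this]

variable {R : Type*} [Ring R] {B : Type*} [AddCommGroup B] [Module R B]

theorem exists_surjective_pi (e : R ≃ₗ[R] B) (X : Type*) [AddCommGroup X] [Module R X]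
    [Module.Finite R X] : ∃ (m : ℕ) (f : (Fin m → B) →ₗ[R] X), Function.Surjective f := by
  obtain ⟨m, f, hf⟩ := Module.Finite.exists_fin' R X
  exact ⟨m, f ∘ₗ (LinearEquiv.piCongrRight fun _ => e.symm).toLinearMap,
    hf.comp (LinearEquiv.surjective _)⟩

theorem exists_exact_pi [IsNoetherian R B] (e : R ≃ₗ[R] B) {a : ℕ} {Y : Type*} [AddCommGroup Y]
    [Module R Y] (f : (Fin a → B) →ₗ[R] Y) :
    ∃ (c : ℕ) (g : (Fin c → B) →ₗ[R] (Fin a → B)), Function.Exact g f := by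
  obtain ⟨c, g, hg⟩ := exists_surjective_pi e (LinearMap.ker f)
  refine ⟨c, (LinearMap.ker f).subtype ∘ₗ g, ?_⟩
  rw [LinearMap.exact_iff, LinearMap.range_comp_of_range_eq_top _ (LinearMap.range_eq_top.2 hg),
    Submodule.range_subtype]

/-- A finitely generated module over a noetherian ring has a resolution by finite powers of a
free module `B` of rank one. -/
theorem exists_resolution_pi [IsNoetherian R B] (e : R ≃ₗ[R] B) (X : Type*) [AddCommGroup X]
    [Module R X] [Module.Finite R X] :
    ∃ (m : ℕ → ℕ) (d : ∀ i, (Fin (m (i + 1)) → B) →ₗ[R] (Fin (m i) → B))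
      (p : (Fin (m 0) → B) →ₗ[R] X), Function.Surjective p ∧ Function.Exact (d 0) p ∧
        ∀ i, Function.Exact (d (i + 1)) (d i) := by
  obtain ⟨m₀, p, hp⟩ := exists_surjective_pi e X
  obtain ⟨m₁, d₀, hd₀⟩ := exists_exact_pi e p
  choose c g hg using fun (a b : ℕ) (f : (Fin a → B) →ₗ[R] (Fin b → B)) => exists_exact_pi e f
  -- A state is the latest differential with the ranks of its source and target; the next one covers
  -- its kernel.
  let st : ℕ → Σ (a b : ℕ), (Fin a → B) →ₗ[R] (Fin b → B) := fun n =>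
    Nat.rec ⟨m₁, m₀, d₀⟩ (fun _ s => ⟨c s.1 s.2.1 s.2.2, s.1, g s.1 s.2.1 s.2.2⟩) n
  exact ⟨fun i => (st i).2.1, fun i => (st i).2.2, p, hp, hd₀, fun i => hg _ _ _⟩

variable {Λ : Type u} [Ring Λ]

open scoped Matrix

/-- The left linear functional on row vectors defined by a column vector. -/
def dotRight {m : ℕ} (w : Fin m → Λ) : (Fin m → Λ) →ₗ[Λ] Λ where
  toFun v := v ⬝ᵥ w
  map_add' _ _ := add_dotProduct _ _ _
  map_smul' _ _ := smul_dotProduct _ _ _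

@[simp]
theorem dotRight_apply {m : ℕ} (v w : Fin m → Λ) : dotRight w v = v ⬝ᵥ w := rfl

theorem sum_op_smul_single {m : ℕ} (w : Fin m → Λ) :
    ∑ i, op (w i) • (Pi.single i 1 : Fin m → Λ) = w := by
  ext j
  simp [Finset.sum_apply, Pi.single_apply]

theorem sum_smul_single {m : ℕ} (v : Fin m → Λ) :
    ∑ i, v i • (Pi.single i 1 : Fin m → Λ) = v := by
  ext j
  simp [Finset.sum_apply, Pi.single_apply]

theorem map_eq_sum_op_smul {m : ℕ} {N : Type*} [AddCommGroup N] [Module Λᵐᵒᵖ N]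
    (f : (Fin m → Λ) →ₗ[Λᵐᵒᵖ] N) (w : Fin m → Λ) :
    f w = ∑ i, op (w i) • f (Pi.single i 1) := by
  conv_lhs => rw [← sum_op_smul_single w]
  simp only [map_sum, map_smul]

theorem map_eq_sum_smul {m : ℕ} {N : Type*} [AddCommGroup N] [Module Λ N]
    (f : (Fin m → Λ) →ₗ[Λ] N) (v : Fin m → Λ) :
    f v = ∑ i, v i • f (Pi.single i 1) := by
  conv_lhs => rw [← sum_smul_single v]
  simp only [map_sum, map_smul]

theorem right_functional_eq_dotProduct {m : ℕ} (f : (Fin m → Λ) →ₗ[Λᵐᵒᵖ] Λ) (w : Fin m → Λ) :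
    f w = (fun i => f (Pi.single i 1)) ⬝ᵥ w := by
  rw [map_eq_sum_op_smul]
  rfl

theorem left_functional_eq_dotRight {m : ℕ} (f : (Fin m → Λ) →ₗ[Λ] Λ) :
    f = dotRight (fun i => f (Pi.single i 1)) := by
  refine LinearMap.ext fun v => ?_
  rw [map_eq_sum_smul]
  rfl

/-- The transpose of a right linear map between column vectors, acting on row vectors. -/
def transpose {a b : ℕ} (d : (Fin a → Λ) →ₗ[Λᵐᵒᵖ] (Fin b → Λ)) :
    (Fin b → Λ) →ₗ[Λ] (Fin a → Λ) :=
  LinearMap.pi fun j => dotRight (d (Pi.single j 1))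

/-- Right maps act on columns and left maps on rows; the dot product pairs the two, and
transposition is adjunction for this pairing. -/
theorem transpose_dotProduct {a b : ℕ} (d : (Fin a → Λ) →ₗ[Λᵐᵒᵖ] (Fin b → Λ))
    (v : Fin b → Λ) (w : Fin a → Λ) : transpose d v ⬝ᵥ w = v ⬝ᵥ d w := by
  let f : (Fin b → Λ) →ₗ[Λᵐᵒᵖ] Λ :=
    { toFun := fun x => v ⬝ᵥ x
      map_add' := fun _ _ => dotProduct_add _ _ _
      map_smul' := fun r x => by
        simp [dotProduct, Finset.sum_mul, mul_assoc] }
  exact (right_functional_eq_dotProduct (f ∘ₗ d) w).symm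

theorem eq_of_forall_dotProduct {m : ℕ} {w w' : Fin m → Λ}
    (h : ∀ v : Fin m → Λ, v ⬝ᵥ w = v ⬝ᵥ w') : w = w' := by
  ext i
  simpa using h (Pi.single i 1)

theorem transpose_comp_eq_zero {a b c : ℕ} (d : (Fin a → Λ) →ₗ[Λᵐᵒᵖ] (Fin b → Λ))
    (d' : (Fin b → Λ) →ₗ[Λᵐᵒᵖ] (Fin c → Λ)) (h : ∀ w, d' (d w) = 0) (v : Fin c → Λ) :
    transpose d (transpose d' v) = 0 := by
  ext i
  have := transpose_dotProduct d (transpose d' v) (Pi.single i 1)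
  rw [transpose_dotProduct d', h] at this
  simpa using this

end FreeModules

/-! ### Dimension shifting for Ext over a ring. -/

section Ext

variable {R : Type u} [Ring R]

theorem subsingleton_ext_X₁ {S : ShortComplex (ModuleCat.{u} R)} (hS : S.ShortExact)
    (L : ModuleCat.{u} R) (n : ℕ) [Subsingleton (Ext.{u} S.X₂ L n)]
    [Subsingleton (Ext.{u} S.X₃ L (n + 1))] : Subsingleton (Ext.{u} S.X₁ L n) := by
  refine subsingleton_of_forall_eq 0 fun x => ?_
  obtain ⟨y, rfl⟩ := Ext.contravariant_sequence_exact₁ hS L x (add_comm 1 n)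
    (Subsingleton.elim _ _)
  rw [Subsingleton.elim y 0, Ext.comp_zero]

theorem subsingleton_ext_X₃ {S : ShortComplex (ModuleCat.{u} R)} (hS : S.ShortExact)
    (L : ModuleCat.{u} R) (n : ℕ) [Subsingleton (Ext.{u} S.X₁ L n)]
    [Subsingleton (Ext.{u} S.X₂ L (n + 1))] : Subsingleton (Ext.{u} S.X₃ L (n + 1)) := by
  refine subsingleton_of_forall_eq 0 fun x => ?_
  obtain ⟨y, rfl⟩ := Ext.contravariant_sequence_exact₃ hS L x (Subsingleton.elim _ _)
    (add_comm 1 n)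
  rw [Subsingleton.elim y 0, Ext.comp_zero]

theorem subsingleton_ext_covariant_X₃ {S : ShortComplex (ModuleCat.{u} R)} (hS : S.ShortExact)
    (Y : ModuleCat.{u} R) (n : ℕ) [Subsingleton (Ext.{u} Y S.X₂ n)]
    [Subsingleton (Ext.{u} Y S.X₁ (n + 1))] : Subsingleton (Ext.{u} Y S.X₃ n) := by
  refine subsingleton_of_forall_eq 0 fun x => ?_
  obtain ⟨y, rfl⟩ := Ext.covariant_sequence_exact₃ Y hS x rfl (Subsingleton.elim _ _)
  rw [Subsingleton.elim y 0, Ext.zero_comp]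

theorem subsingleton_ext_covariant_X₁ {S : ShortComplex (ModuleCat.{u} R)} (hS : S.ShortExact)
    (Y : ModuleCat.{u} R) (n : ℕ) [Subsingleton (Ext.{u} Y S.X₃ n)]
    [Subsingleton (Ext.{u} Y S.X₂ (n + 1))] : Subsingleton (Ext.{u} Y S.X₁ (n + 1)) := by
  refine subsingleton_of_forall_eq 0 fun x => ?_
  obtain ⟨y, rfl⟩ := Ext.covariant_sequence_exact₁ Y hS x (Subsingleton.elim _ _) rfl
  rw [Subsingleton.elim y 0, Ext.zero_comp]

/-- Homomorphisms from the first term of a short exact sequence extend to the middle term when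
`Ext¹` of the last term vanishes. -/
theorem exists_extension_of_ext_one {S : ShortComplex (ModuleCat.{u} R)} (hS : S.ShortExact)
    {L : ModuleCat.{u} R} (h : Subsingleton (Ext.{u} S.X₃ L 1)) (f : S.X₁ ⟶ L) :
    ∃ g : S.X₂ ⟶ L, S.f ≫ g = f := by
  obtain ⟨y, hy⟩ := Ext.contravariant_sequence_exact₁ hS L (Ext.mk₀ f) (add_zero 1)
    (Subsingleton.elim _ _)
  obtain ⟨g, rfl⟩ := (Ext.mk₀_bijective _ _).2 y
  exact ⟨g, (Ext.mk₀_bijective _ _).1 (by rw [← hy, Ext.mk₀_comp_mk₀])⟩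

theorem subsingleton_ext_one_of_extension {S : ShortComplex (ModuleCat.{u} R)}
    (hS : S.ShortExact) {L : ModuleCat.{u} R} [Subsingleton (Ext.{u} S.X₂ L 1)]
    (h : ∀ f : S.X₁ ⟶ L, ∃ g : S.X₂ ⟶ L, S.f ≫ g = f) :
    Subsingleton (Ext.{u} S.X₃ L 1) := by
  refine subsingleton_of_forall_eq 0 fun x => ?_
  obtain ⟨y, rfl⟩ := Ext.contravariant_sequence_exact₃ hS L x (Subsingleton.elim _ _)
    (add_zero 1)
  obtain ⟨f, rfl⟩ := (Ext.mk₀_bijective _ _).2 y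
  obtain ⟨g, rfl⟩ := h f
  rw [← Ext.mk₀_comp_mk₀, ShortComplex.ShortExact.extClass_comp_assoc]

theorem shortExact_of_exact {A B C : Type u} [AddCommGroup A] [AddCommGroup B] [AddCommGroup C]
    [Module R A] [Module R B] [Module R C] {f : A →ₗ[R] B} {g : B →ₗ[R] C}
    (hf : Function.Injective f) (h : Function.Exact f g) (hg : Function.Surjective g) :
    (ModuleCat.shortComplexOfCompEqZero f g h.linearMap_comp_eq_zero).ShortExact :=
  ModuleCat.shortComplex_shortExact _ h hf hg

/-- Vanishing of `Extʲ⁺¹(X, L)` in terms of a projective resolution of `X`. -/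
theorem exists_eq_comp_of_subsingleton_ext (L : Type u) [AddCommGroup L] [Module R L] (j : ℕ)
    (X : Type u) [AddCommGroup X] [Module R X]
    (P : ℕ → Type u) [∀ i, AddCommGroup (P i)] [∀ i, Module R (P i)] [∀ i, Module.Projective R (P i)]
    (d : ∀ i, P (i + 1) →ₗ[R] P i) (p : P 0 →ₗ[R] X) (hp : Function.Surjective p)
    (h₀ : Function.Exact (d 0) p) (hd : ∀ i, Function.Exact (d (i + 1)) (d i))
    (h : Subsingleton (Ext.{u} (ModuleCat.of R X) (ModuleCat.of R L) (j + 1)))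
    (f : P (j + 1) →ₗ[R] L) (hf : f ∘ₗ d (j + 1) = 0) : ∃ g : P j →ₗ[R] L, g ∘ₗ d j = f := by
  have hex : Function.Exact (LinearMap.range (d 0)).subtype p := by
    rw [LinearMap.exact_iff, Submodule.range_subtype, LinearMap.exact_iff.1 h₀]
  have hS := shortExact_of_exact (Submodule.injective_subtype _) hex hp
  induction j generalizing X P with
  | zero =>
    -- As `f` kills the image of `d 1`, which is the kernel of `d 0`, it descends to the first
    -- syzygy; there Ext¹(X, L) = 0 extends it to `P 0`.
    obtain ⟨f', hf'⟩ := exists_comp_eq_of_ker_le (LinearMap.surjective_rangeRestrict (d 0)) f (by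
      rw [LinearMap.ker_rangeRestrict, LinearMap.exact_iff.1 (hd 0)]
      exact LinearMap.range_le_ker_iff.2 hf)
    obtain ⟨g, hg⟩ := exists_extension_of_ext_one hS (L := ModuleCat.of R L) h (ModuleCat.ofHom f')
    refine ⟨g.hom, ?_⟩
    ext x
    have := congr($hg ⟨d 0 x, x, rfl⟩)
    rw [← hf']
    exact this
  | succ j ih =>
    have hex' : Function.Exact (d 1) (d 0).rangeRestrict := by
      rw [LinearMap.exact_iff, LinearMap.ker_rangeRestrict]
      exact LinearMap.exact_iff.1 (hd 0)
    refine ih (LinearMap.range (d 0)) (fun i => P (i + 1)) (fun i => d (i + 1))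
      (d 0).rangeRestrict (LinearMap.surjective_rangeRestrict _) hex' (fun i => hd (i + 1)) ?_ f hf
      ?_ ?_
    · have : Projective (ModuleCat.of R (P 0)) := inferInstance
      have : Subsingleton (Ext.{u} (ModuleCat.of R (P 0)) (ModuleCat.of R L) (j + 1)) :=
        Ext.subsingleton_of_projective _ _ _
      exact subsingleton_ext_X₁ hS (ModuleCat.of R L) (j + 1)
    · rw [LinearMap.exact_iff, Submodule.range_subtype, LinearMap.exact_iff.1 hex']
    · refine shortExact_of_exact (Submodule.injective_subtype _) ?_
        (LinearMap.surjective_rangeRestrict _)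
      rw [LinearMap.exact_iff, Submodule.range_subtype, LinearMap.exact_iff.1 hex']

theorem hom_eq_zero_of_subsingleton_ext_zero {X L : ModuleCat.{u} R}
    (h : Subsingleton (Ext.{u} X L 0)) (f : X ⟶ L) : f = 0 :=
  (Ext.mk₀_bijective _ _).1 (Subsingleton.elim _ _)

/-- The identity of Rᵐ is the sum of the projections followed by the inclusions, so a class is
determined by its components. -/
theorem ext_pi_eq_zero {Y : ModuleCat.{u} R} {m n : ℕ}
    (x : Ext.{u} Y (ModuleCat.of R (Fin m → R)) n)
    (h : ∀ i, x.comp (Ext.mk₀ (ModuleCat.ofHom (LinearMap.proj (R := R) (φ := fun _ => R) i)))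
      (add_zero n) = 0) : x = 0 := by
  have key : 𝟙 (ModuleCat.of R (Fin m → R)) = ∑ i : Fin m,
      ModuleCat.ofHom (LinearMap.proj (R := R) (φ := fun _ => R) i) ≫
        ModuleCat.ofHom (LinearMap.single R (fun _ => R) i) := by
    ext v : 2
    simp only [ModuleCat.hom_sum, ModuleCat.hom_comp]
    ext j
    simp [Pi.single_apply]
  rw [← Ext.comp_mk₀_id x, key, Ext.mk₀_sum, Ext.comp_sum]
  refine Finset.sum_eq_zero fun i _ => ?_
  rw [← Ext.mk₀_comp_mk₀, ← Ext.comp_assoc_of_third_deg_zero, h, Ext.zero_comp]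

theorem subsingleton_ext_pi {Y : ModuleCat.{u} R} (m n : ℕ)
    [Subsingleton (Ext.{u} Y (ModuleCat.of R R) n)] :
    Subsingleton (Ext.{u} Y (ModuleCat.of R (Fin m → R)) n) :=
  subsingleton_of_forall_eq 0 fun x => ext_pi_eq_zero x fun _ => Subsingleton.elim _ _

/-- If `Extˡ(Y, R) = 0` for `i ≤ l < i + n`, then `Extⁱ(Y, Z) = 0` for all finitely generated
modules `Z` of projective dimension less than `n`. -/
theorem subsingleton_ext_of_hasProjectiveDimensionLT [IsNoetherianRing R] (Y : ModuleCat.{u} R)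
    (n : ℕ) : ∀ (i : ℕ) (Z : ModuleCat.{u} R) [Module.Finite R Z] [HasProjectiveDimensionLT Z n],
      (∀ l, i ≤ l → l < i + n → Subsingleton (Ext.{u} Y (ModuleCat.of R R) l)) →
      Subsingleton (Ext.{u} Y Z i) := by
  induction n with
  | zero =>
    intro i Z _ _ _
    have hZ : Limits.IsZero Z := isZero_of_hasProjectiveDimensionLT_zero Z
    refine subsingleton_of_forall_eq 0 fun x => ?_
    rw [← Ext.comp_mk₀_id x, hZ.eq_of_src (𝟙 Z) 0, Ext.mk₀_zero, Ext.comp_zero]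
  | succ n ih =>
    intro i Z _ _ hY
    obtain ⟨m, p, hp⟩ := Module.Finite.exists_fin' R Z
    have : Subsingleton (Ext.{u} Y (ModuleCat.of R R) i) := hY i le_rfl (by lia)
    have hpi : Subsingleton (Ext.{u} Y (ModuleCat.of R (Fin m → R)) i) := subsingleton_ext_pi m i
    have hS := LinearMap.shortExact_shortComplexKer hp
    -- A projective Z is a summand of Rᵐ and needs no shift; otherwise the syzygy has smaller
    -- dimension and the degree rises by one.
    rcases n with _ | n
    · have : Projective Z := projective_iff_hasProjectiveDimensionLT_one.2 ‹_›
      have : Epi (ModuleCat.ofHom p) := (ModuleCat.epi_iff_surjective _).2 hp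
      refine subsingleton_of_forall_eq 0 fun x => ?_
      rw [← Ext.comp_mk₀_id x, ← Projective.factorThru_comp (𝟙 Z) (ModuleCat.ofHom p),
        ← Ext.mk₀_comp_mk₀, ← Ext.comp_assoc_of_third_deg_zero,
        Subsingleton.elim (x.comp _ _) 0, Ext.zero_comp]
    · have : Projective (ModuleCat.of R (Fin m → R)) := inferInstance
      have hK : HasProjectiveDimensionLT (ModuleCat.of R (LinearMap.ker p)) (n + 1) :=
        (hS.hasProjectiveDimensionLT_X₃_iff n this).1 ‹_›
      have : Subsingleton (Ext.{u} Y (ModuleCat.of R (LinearMap.ker p)) (i + 1)) :=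
        ih (i + 1) _ fun l h₁ h₂ => hY l (by lia) (by lia)
      exact subsingleton_ext_covariant_X₃ hS Y i

end Ext

/-! ### The right module Extⁱ(M, Λ) and its finiteness. -/

section ExtRing

variable {Λ : Type u} [Ring Λ]

/-- Composition with an extension class, as a map of right `Λ`-modules. -/
def extRingComp {X Q : ModuleCat.{u} Λ} {i n m : ℕ} (ξ : Ext.{u} X Q i) (h : i + n = m) :
    ExtRing Q n →ₗ[Λᵐᵒᵖ] ExtRing X m where
  toFun x := ξ.comp (show Ext.{u} Q (ModuleCat.of Λ Λ) n from x) h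
  map_add' _ _ := Ext.comp_add _ _ _ _
  map_smul' r x := (Ext.comp_assoc_of_third_deg_zero ξ
    (show Ext.{u} Q (ModuleCat.of Λ Λ) n from x) (Ext.mk₀ (rightMul r.unop)) h).symm

/-- The canonical map from `Hom(M, Λ)` to `Ext⁰(M, Λ)`. -/
def homToExtRing (M : ModuleCat.{u} Λ) : (M →ₗ[Λ] Λ) →ₗ[Λᵐᵒᵖ] ExtRing M 0 where
  toFun f := Ext.mk₀ (ModuleCat.ofHom f)
  map_add' f g := Ext.mk₀_add (ModuleCat.ofHom f) (ModuleCat.ofHom g)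
  map_smul' r f := by
    refine Eq.trans ?_ (Ext.mk₀_comp_mk₀ (ModuleCat.ofHom f) (rightMul r.unop)).symm
    rfl

theorem homToExtRing_surjective (M : ModuleCat.{u} Λ) :
    Function.Surjective (homToExtRing M) := fun x => by
  obtain ⟨f, hf⟩ := (Ext.mk₀_bijective _ _).2 x
  exact ⟨f.hom, hf⟩

theorem finite_dual [IsNoetherianRing Λᵐᵒᵖ] (M : ModuleCat.{u} Λ) [Module.Finite Λ M] :
    Module.Finite Λᵐᵒᵖ (M →ₗ[Λ] Λ) := by
  obtain ⟨m, p, hp⟩ := Module.Finite.exists_fin' Λ M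
  have : IsNoetherian Λᵐᵒᵖ Λ := isNoetherian_of_linearEquiv (opLinearEquiv Λᵐᵒᵖ).symm
  let g : (M →ₗ[Λ] Λ) →ₗ[Λᵐᵒᵖ] (Fin m → Λ) :=
    { toFun := fun f i => f (p (Pi.single i 1))
      map_add' := fun _ _ => rfl
      map_smul' := fun _ _ => rfl }
  refine Module.Finite.of_injective g fun f f' h => ?_
  refine LinearMap.ext fun x => ?_
  obtain ⟨v, rfl⟩ := hp x
  rw [← LinearMap.comp_apply, ← LinearMap.comp_apply, map_eq_sum_smul (f ∘ₗ p),
    map_eq_sum_smul (f' ∘ₗ p)]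
  exact Finset.sum_congr rfl fun i _ => congrArg (v i • ·) (congrFun h i)

/-- Syzygies stay finitely generated by left noetherianity, and connecting maps reduce to degree 0,
where the dual embeds in a power of the right noetherian module Λ. -/
theorem finite_extRing [IsNoetherianRing Λ] [IsNoetherianRing Λᵐᵒᵖ] (n : ℕ) :
    ∀ (M : ModuleCat.{u} Λ) [Module.Finite Λ M], Module.Finite Λᵐᵒᵖ (ExtRing M n) := by
  induction n with
  | zero =>
    intro M _
    have := finite_dual M
    exact Module.Finite.of_surjective _ (homToExtRing_surjective M)
  | succ n ih =>
    intro M _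
    obtain ⟨m, p, hp⟩ := Module.Finite.exists_fin' Λ M
    have hS := LinearMap.shortExact_shortComplexKer hp
    have := ih (ModuleCat.of Λ (LinearMap.ker p))
    have : Projective (ModuleCat.of Λ (Fin m → Λ)) := inferInstance
    refine Module.Finite.of_surjective (extRingComp hS.extClass (add_comm 1 n)) fun x => ?_
    exact Ext.contravariant_sequence_exact₃ hS _ x (Ext.eq_zero_of_projective _) (add_comm 1 n)

end ExtRing

/-! ### The dual of a free resolution and the extension classes it carries. -/

section DualComplex

variable {Λ : Type u} [Ring Λ] {m : ℕ → ℕ}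
  (d : ∀ i, (Fin (m (i + 1)) → Λ) →ₗ[Λᵐᵒᵖ] (Fin (m i) → Λ))

/-- The coboundaries of the dual of a complex of free right modules. -/
def dualBoundary : ∀ j, Submodule Λ (Fin (m j) → Λ)
  | 0 => ⊥
  | j + 1 => LinearMap.range (transpose (d j))

/-- The cokernels of the dual of a complex of free right modules. -/
abbrev DualCoker (j : ℕ) : Type u := (Fin (m j) → Λ) ⧸ dualBoundary d j

variable {d} (hd : ∀ i, Function.Exact (d (i + 1)) (d i))

include hd in
theorem dualBoundary_le_ker (j : ℕ) :
    dualBoundary d j ≤ LinearMap.ker (transpose (d j)) := by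
  rcases j with _ | j
  · exact bot_le
  · rintro _ ⟨v, rfl⟩
    exact transpose_comp_eq_zero _ _ (hd j).apply_apply_eq_zero v

/-- The map from a cokernel of the dual complex to the next term. -/
def dualCokerMap (j : ℕ) : DualCoker d j →ₗ[Λ] (Fin (m (j + 1)) → Λ) :=
  (dualBoundary d j).liftQ (transpose (d j)) (dualBoundary_le_ker hd j)

theorem dualCokerMap_exact (j : ℕ) :
    Function.Exact (dualCokerMap hd j) (dualBoundary d (j + 1)).mkQ := by
  rw [LinearMap.exact_iff, Submodule.ker_mkQ, dualCokerMap, Submodule.range_liftQ]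
  rfl

theorem dualCokerMap_injective {j : ℕ}
    (h : LinearMap.ker (transpose (d j)) ≤ dualBoundary d j) :
    Function.Injective (dualCokerMap hd j) := by
  rw [← LinearMap.ker_eq_bot, dualCokerMap]
  exact Submodule.ker_liftQ_eq_bot _ _ _ h

theorem dualCoker_shortExact {j : ℕ} (h : LinearMap.ker (transpose (d j)) ≤ dualBoundary d j) :
    (ModuleCat.shortComplexOfCompEqZero (dualCokerMap hd j) (dualBoundary d (j + 1)).mkQ
      (dualCokerMap_exact hd j).linearMap_comp_eq_zero).ShortExact :=
  shortExact_of_exact (dualCokerMap_injective hd h) (dualCokerMap_exact hd j)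
    (Submodule.mkQ_surjective _)

/-- Every functional on a cokernel of the dual complex (in positive degree) extends to the next
term. -/
theorem exists_functional_extension (j : ℕ) (φ : DualCoker d (j + 1) →ₗ[Λ] Λ) :
    ∃ w, dotRight w ∘ₗ dualCokerMap hd (j + 1) = φ := by
  have hφ := left_functional_eq_dotRight (φ ∘ₗ (dualBoundary d (j + 1)).mkQ)
  generalize hw : (fun i => (φ ∘ₗ (dualBoundary d (j + 1)).mkQ) (Pi.single i 1)) = w at hφ
  -- Vanishing on coboundaries says that the column `w` is a cycle. Exactness of the resolution
  -- makes it a boundary `d (j + 1) q`, and `q` is the extended functional.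
  have hdw : d j w = 0 := eq_of_forall_dotProduct fun v => by
    have hv : (dualBoundary d (j + 1)).mkQ (transpose (d j) v) = 0 :=
      (Submodule.Quotient.mk_eq_zero (dualBoundary d (j + 1))).2 ⟨v, rfl⟩
    rw [← transpose_dotProduct, dotProduct_zero, ← dotRight_apply, ← hφ, LinearMap.comp_apply,
      hv, map_zero]
  obtain ⟨q, rfl⟩ := (hd j w).1 hdw
  refine ⟨q, ?_⟩
  refine Submodule.linearMap_qext _ (LinearMap.ext fun v => ?_)
  rw [hφ]
  exact transpose_dotProduct _ _ _

/-- The extension class with prescribed components. -/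
def classOfMap {X : ModuleCat.{u} Λ} {a n : ℕ} (p : (Fin a → Λ) →ₗ[Λᵐᵒᵖ] ExtRing X n) :
    Ext.{u} X (ModuleCat.of Λ (Fin a → Λ)) n :=
  ∑ i, Ext.comp (show Ext.{u} X (ModuleCat.of Λ Λ) n from p (Pi.single i 1))
    (Ext.mk₀ (ModuleCat.ofHom (LinearMap.single Λ (fun _ => Λ) i))) (add_zero n)

/-- A functional on Λᵃ is a column, so this product recovers `p` itself: `classOfMap p` is the
universal class encoding `p`. -/
theorem classOfMap_comp {X : ModuleCat.{u} Λ} {a n : ℕ} (p : (Fin a → Λ) →ₗ[Λᵐᵒᵖ] ExtRing X n)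
    (w : Fin a → Λ) :
    (classOfMap p).comp (Ext.mk₀ (ModuleCat.ofHom (dotRight w))) (add_zero n) = p w := by
  rw [classOfMap, Ext.sum_comp, map_eq_sum_op_smul]
  refine Finset.sum_congr rfl fun i _ => ?_
  rw [Ext.comp_assoc_of_third_deg_zero, Ext.mk₀_comp_mk₀]
  have : ModuleCat.ofHom (LinearMap.single Λ (fun _ => Λ) i) ≫ ModuleCat.ofHom (dotRight w) =
      rightMul (w i) := by
    ext
    simp [rightMul]
  rw [this]
  rfl

variable {X : ModuleCat.{u} Λ} {n : ℕ} {p : (Fin (m 0) → Λ) →ₗ[Λᵐᵒᵖ] ExtRing X (n + 1)}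

/-- Dimension shifting along the dual of a resolution of `Extⁿ⁺¹(X, Λ)`. -/
theorem exists_class_dualCoker (hW : IsWModule n X) (hp : Function.Surjective p)
    (h₀ : Function.Exact (d 0) p)
    (hker : ∀ j < n, LinearMap.ker (transpose (d j)) ≤ dualBoundary d j) (j : ℕ) (hj : j ≤ n) :
    HasProjectiveDimensionLE (ModuleCat.of Λ (DualCoker d j)) j ∧
    (∀ i, 1 ≤ i → i < j →
      Subsingleton (Ext.{u} (ModuleCat.of Λ (DualCoker d j)) (ModuleCat.of Λ Λ) i)) ∧
    ∃ (s : ℕ) (hs : s + j = n + 1) (ξ : Ext.{u} X (ModuleCat.of Λ (DualCoker d j)) s),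
      (∀ e : Ext.{u} X (ModuleCat.of Λ Λ) (n + 1), ∃ x, ξ.comp x hs = e) ∧
      (∀ x : Ext.{u} (ModuleCat.of Λ (DualCoker d j)) (ModuleCat.of Λ Λ) j, ξ.comp x hs = 0 →
        ∃ y, (Ext.mk₀ (ModuleCat.ofHom (dualCokerMap hd j))).comp y (zero_add j) = x) ∧
      ξ.comp (Ext.mk₀ (ModuleCat.ofHom (dualCokerMap hd j))) (add_zero s) = 0 := by
  induction j with
  | zero =>
    let q : ModuleCat.of Λ (Fin (m 0) → Λ) ⟶ ModuleCat.of Λ (DualCoker d 0) :=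
      ModuleCat.ofHom (dualBoundary d 0).mkQ
    -- In degree 0 the boundaries are `⊥`, so the cokernel is the free module P₀* itself.
    have hq : Projective (ModuleCat.of Λ (DualCoker d 0)) := by
      have : Module.Projective Λ (DualCoker d 0) :=
        Module.Projective.of_equiv (Submodule.quotEquivOfEqBot (dualBoundary d 0) rfl).symm
      infer_instance
    have hcomp : ∀ (φ : DualCoker d 0 →ₗ[Λ] Λ) w, φ ∘ₗ (dualBoundary d 0).mkQ = dotRight w →
        ((classOfMap p).comp (Ext.mk₀ q) (add_zero _)).comp (Ext.mk₀ (ModuleCat.ofHom φ))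
          (add_zero _) = p w := by
      intro φ w h
      rw [Ext.comp_assoc_of_third_deg_zero, Ext.mk₀_comp_mk₀, ← ModuleCat.ofHom_comp, h,
        classOfMap_comp]
    refine ⟨(projective_iff_hasProjectiveDimensionLE_zero _).1 hq, fun i h₁ h₂ => by lia, n + 1, rfl,
      (classOfMap p).comp (Ext.mk₀ q) (add_zero _), fun e => ?_, fun x hx => ?_, ?_⟩
    · obtain ⟨w, rfl⟩ := hp e
      exact ⟨Ext.mk₀ (ModuleCat.ofHom ((dualBoundary d 0).liftQ (dotRight w) bot_le)),
        hcomp _ w (Submodule.liftQ_mkQ _ _ _)⟩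
    · obtain ⟨φ, rfl⟩ := (Ext.mk₀_bijective _ _).2 x
      have hφ := left_functional_eq_dotRight (φ.hom ∘ₗ (dualBoundary d 0).mkQ)
      generalize hw : (fun i => (φ.hom ∘ₗ (dualBoundary d 0).mkQ) (Pi.single i 1)) = w at hφ
      -- The product is `p w`; if it vanishes then `w = d 0 u`, and `u` is a functional on the next
      -- free module.
      obtain ⟨u, rfl⟩ := (h₀ w).1 ((hcomp _ _ hφ).symm.trans hx)
      refine ⟨Ext.mk₀ (ModuleCat.ofHom (dotRight u)), ?_⟩
      rw [Ext.mk₀_comp_mk₀]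
      congr 1
      refine ModuleCat.hom_ext (Submodule.linearMap_qext _ (LinearMap.ext fun v => ?_))
      rw [hφ]
      exact transpose_dotProduct _ _ _
    · refine ext_pi_eq_zero _ fun i => ?_
      rw [Ext.comp_assoc_of_third_deg_zero, Ext.mk₀_comp_mk₀, ← ModuleCat.ofHom_comp,
        hcomp _ (d 0 (Pi.single i 1)) rfl]
      exact h₀.apply_apply_eq_zero _
  | succ j ih =>
    obtain ⟨hpd, hvan, s, hs, ξ, hsurj, hinj, hzero⟩ := ih (by lia)
    have hS := dualCoker_shortExact hd (hker j (by lia))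
    have hP : Projective (ModuleCat.of Λ (Fin (m (j + 1)) → Λ)) := inferInstance
    obtain ⟨s, rfl⟩ : ∃ t, s = t + 1 := ⟨s - 1, by lia⟩
    -- The class dies in the next free module, so it comes from the next cokernel in one degree
    -- less.
    obtain ⟨ξ', rfl⟩ := Ext.covariant_sequence_exact₁ X hS ξ hzero rfl
    have hconn : ∀ i, ∀ x : Ext.{u} (ModuleCat.of Λ (DualCoker d (j + 1))) (ModuleCat.of Λ Λ)
        (i + 1), ∃ y, hS.extClass.comp y (add_comm 1 i) = x := fun i x =>
      Ext.contravariant_sequence_exact₃ hS _ x (Ext.eq_zero_of_projective _) (add_comm 1 i)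
    have hassoc : ∀ y : Ext.{u} (ModuleCat.of Λ (DualCoker d j)) (ModuleCat.of Λ Λ) j,
        ξ'.comp (hS.extClass.comp y (add_comm 1 j)) (by lia) =
          (ξ'.comp hS.extClass rfl).comp y hs := fun y =>
      (Ext.comp_assoc _ _ _ _ _ (by lia)).symm
    -- Past degree 0 the product is injective: the ambiguity left in the previous degree extends to
    -- the free middle term, and the connecting map kills it.
    have hinj' : ∀ x : Ext.{u} (ModuleCat.of Λ (DualCoker d (j + 1))) (ModuleCat.of Λ Λ) (j + 1),
        ξ'.comp x (by lia : s + (j + 1) = n + 1) = 0 → x = 0 := by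
      intro x hx
      obtain ⟨y, rfl⟩ := hconn j x
      obtain ⟨z, rfl⟩ := hinj y ((hassoc y).symm.trans hx)
      exact hS.extClass_comp_assoc z
    refine ⟨hS.hasProjectiveDimensionLT_X₃ (j + 1) hpd inferInstance, fun i h₁ h₂ => ?_, s,
      by lia, ξ', fun e => ?_, fun x hx => ⟨0, ?_⟩, ?_⟩
    · obtain ⟨i, rfl⟩ : ∃ t, i = t + 1 := ⟨i - 1, by lia⟩
      rcases i with _ | i
      -- Here 1 < j + 1, so the cokernel in degree `j` has positive index and its functionals
      -- extend.
      · obtain ⟨j, rfl⟩ : ∃ t, j = t + 1 := ⟨j - 1, by lia⟩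
        have := Ext.subsingleton_of_projective (ModuleCat.of Λ (Fin (m (j + 1 + 1)) → Λ))
          (ModuleCat.of Λ Λ) 0
        refine subsingleton_ext_one_of_extension hS fun φ => ?_
        obtain ⟨w, hw⟩ := exists_functional_extension hd j φ.hom
        exact ⟨ModuleCat.ofHom (dotRight w), ModuleCat.hom_ext hw⟩
      · have := Ext.subsingleton_of_projective (ModuleCat.of Λ (Fin (m (j + 1)) → Λ))
          (ModuleCat.of Λ Λ) (i + 1)
        have := hvan (i + 1) (by lia) (by lia)
        exact subsingleton_ext_X₃ hS _ _
    · obtain ⟨y, rfl⟩ := hsurj e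
      exact ⟨hS.extClass.comp y (add_comm 1 j), hassoc y⟩
    · rw [Ext.comp_zero, hinj' x hx]
    -- Now s = n - j lies between 1 and n, so the W-condition kills every class in a free module.
    · have : Subsingleton (Ext.{u} X (ModuleCat.of Λ Λ) s) := hW s (by lia) (by lia)
      have := subsingleton_ext_pi (Y := X) (m (j + 1 + 1)) s
      exact Subsingleton.elim _ _

end DualComplex

/-! ### The module Q and the class ξ. -/

section Step

variable {Λ : Type u} [Ring Λ] [IsNoetherianRing Λ] [IsNoetherianRing Λᵐᵒᵖ]

/-- Grade at least `n` is exactness of the dualized resolution below degree `n`, which lets the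
shifting run down to Ext¹. Injectivity is asked only for `1 ≤ n`: for `n = 0` the product is P₀ →
Ext¹(X, Λ), usually not injective. -/
theorem exists_class_of_gradeGE (X : ModuleCat.{u} Λ) [Module.Finite Λ X] (n : ℕ)
    (hW : IsWModule n X) (hG : GradeGE n (ModuleCat.of Λᵐᵒᵖ (ExtRing X (n + 1)))) :
    ∃ (Q : ModuleCat.{u} Λ) (ξ : Ext.{u} X Q 1), Module.Finite Λ Q ∧
      HasProjectiveDimensionLE Q n ∧
      (∀ i, 1 ≤ i → i < n → Subsingleton (Ext.{u} Q (ModuleCat.of Λ Λ) i)) ∧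
      (∀ e : Ext.{u} X (ModuleCat.of Λ Λ) (n + 1), ∃ x, ξ.comp x (add_comm 1 n) = e) ∧
      (1 ≤ n → ∀ x : Ext.{u} Q (ModuleCat.of Λ Λ) n, ξ.comp x (add_comm 1 n) = 0 → x = 0) := by
  have : IsNoetherian Λᵐᵒᵖ Λ := isNoetherian_of_linearEquiv (opLinearEquiv Λᵐᵒᵖ).symm
  have := finite_extRing (n + 1) X
  obtain ⟨m, d, p, hp, h₀, hd⟩ :=
    exists_resolution_pi (opLinearEquiv Λᵐᵒᵖ : Λ ≃ₗ[Λᵐᵒᵖ] Λᵐᵒᵖ).symm (ExtRing X (n + 1))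
  have hker : ∀ j < n, LinearMap.ker (transpose (d j)) ≤ dualBoundary d j := by
    intro j hj v hv
    let f : (Fin (m j) → Λ) →ₗ[Λᵐᵒᵖ] Λ :=
      { toFun := fun x => v ⬝ᵥ x
        map_add' := fun _ _ => dotProduct_add _ _ _
        map_smul' := fun r x => by simp [dotProduct, Finset.sum_mul, mul_assoc] }
    have hf : f ∘ₗ d j = 0 := LinearMap.ext fun w => by
      change v ⬝ᵥ d j w = 0
      rw [← transpose_dotProduct, LinearMap.mem_ker.1 hv, zero_dotProduct]
    rcases j with _ | j
    · obtain ⟨g, hg⟩ := exists_comp_eq_of_ker_le hp f (by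
        rw [LinearMap.exact_iff.1 h₀]
        exact LinearMap.range_le_ker_iff.2 hf)
      have hg0 : g = 0 := congrArg ModuleCat.Hom.hom
        (hom_eq_zero_of_subsingleton_ext_zero (hG 0 hj) (ModuleCat.ofHom g))
      refine (Submodule.mem_bot _).2 (funext fun i => ?_)
      have : f (Pi.single i 1) = 0 := by rw [← hg, hg0]; rfl
      exact (dotProduct_single_one v i).symm.trans this
    · have hproj : ∀ i, Module.Projective Λᵐᵒᵖ (Fin (m i) → Λ) := fun i =>
        Module.Projective.of_equiv
          (LinearEquiv.piCongrRight fun _ : Fin (m i) => (opLinearEquiv Λᵐᵒᵖ : Λ ≃ₗ[Λᵐᵒᵖ] Λᵐᵒᵖ)).symm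
      obtain ⟨g, hg⟩ := exists_eq_comp_of_subsingleton_ext Λ j (ExtRing X (n + 1))
        (fun i => Fin (m i) → Λ) d p hp h₀ hd (hG (j + 1) hj) f hf
      -- The functional of the cocycle `v` factors through `d j`, and the row of coefficients of `g`
      -- is the cochain bounding `v`.
      refine ⟨fun i => g (Pi.single i 1), funext fun i => ?_⟩
      have : f (Pi.single i 1) = g (d j (Pi.single i 1)) := by rw [← hg]; rfl
      rw [right_functional_eq_dotProduct g, ← transpose_dotProduct] at this
      simpa [f] using this.symm
  obtain ⟨hpd, hvan, s, hs, ξ, hsurj, hinj, -⟩ :=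
    exists_class_dualCoker hd hW hp h₀ hker n le_rfl
  obtain rfl : s = 1 := by lia
  refine ⟨_, ξ, inferInstanceAs (Module.Finite Λ (DualCoker d n)), hpd, hvan, hsurj,
    fun hn x hx => ?_⟩
  obtain ⟨y, rfl⟩ := hinj x hx
  obtain ⟨n, rfl⟩ : ∃ t, n = t + 1 := ⟨n - 1, by lia⟩
  -- The ambiguity lies in positive Ext of a free module, hence is zero.
  have : Projective (ModuleCat.of Λ (Fin (m (n + 1 + 1)) → Λ)) := inferInstance
  rw [Ext.eq_zero_of_projective y, Ext.comp_zero]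

end Step

/-! ### Realizing Ext¹ classes by extensions. -/

section Realization

variable {R : Type u} [Ring R]

/-- Every element of `Ext¹` of a finitely generated module is the class of an extension. -/
theorem exists_shortExact_extClass_eq (X Q : ModuleCat.{u} R) [Module.Finite R X]
    [Module.Finite R Q] (ξ : Ext.{u} X Q 1) :
    ∃ (E : ModuleCat.{u} R) (i : Q ⟶ E) (p : E ⟶ X) (w : i ≫ p = 0)
      (hS : (ShortComplex.mk i p w).ShortExact), Module.Finite R E ∧ hS.extClass = ξ := by
  obtain ⟨m, q, hq⟩ := Module.Finite.exists_fin' R X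
  have hT := LinearMap.shortExact_shortComplexKer hq
  have : Projective (ModuleCat.of R (Fin m → R)) := inferInstance
  obtain ⟨y, hy⟩ := Ext.contravariant_sequence_exact₃ hT Q ξ (Ext.eq_zero_of_projective _)
    (add_zero 1)
  obtain ⟨g, rfl⟩ := (Ext.mk₀_bijective _ _).2 y
  -- The extension is the pushout of the free cover of X along `g`, where ξ is the class of that
  -- cover followed by `g`.
  let r : LinearMap.ker q →ₗ[R] (Fin m → R) × Q := (LinearMap.ker q).subtype.prod (-g.hom)
  let N := LinearMap.range r
  let i : Q →ₗ[R] ((Fin m → R) × Q) ⧸ N := N.mkQ ∘ₗ LinearMap.inr R _ _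
  have hN : N ≤ LinearMap.ker (q ∘ₗ LinearMap.fst R (Fin m → R) Q) := by
    rintro _ ⟨x, rfl⟩
    exact x.2
  let p : (((Fin m → R) × Q) ⧸ N) →ₗ[R] X := N.liftQ (q ∘ₗ LinearMap.fst R _ _) hN
  have hi : Function.Injective i := by
    rw [← LinearMap.ker_eq_bot, LinearMap.ker_eq_bot']
    intro z hz
    obtain ⟨x, hx⟩ := (Submodule.Quotient.mk_eq_zero N).1 hz
    have h₁ : x = 0 := Subtype.ext congr(($hx).1)
    have h₂ : (-g.hom) x = z := congr(($hx).2)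
    rw [← h₂, h₁, map_zero]
  have hp : Function.Surjective p := by
    intro x
    obtain ⟨v, rfl⟩ := hq x
    exact ⟨N.mkQ (v, 0), rfl⟩
  have hip : Function.Exact i p := by
    intro x
    obtain ⟨⟨v, z⟩, rfl⟩ := N.mkQ_surjective x
    constructor
    · intro h
      refine ⟨g.hom ⟨v, h⟩ + z, ?_⟩
      refine (Submodule.Quotient.eq N).2 ⟨-⟨v, h⟩, ?_⟩
      simp [r]
    · rintro ⟨z', hz'⟩
      rw [← hz']
      exact map_zero q
  have hS := shortExact_of_exact hi hip hp
  refine ⟨_, _, _, _, hS, inferInstanceAs (Module.Finite R (((Fin m → R) × Q) ⧸ N)), ?_⟩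
  let φ : q.shortComplexKer ⟶
      ModuleCat.shortComplexOfCompEqZero i p hip.linearMap_comp_eq_zero :=
    { τ₁ := g
      τ₂ := ModuleCat.ofHom (N.mkQ ∘ₗ LinearMap.inl R _ _)
      τ₃ := 𝟙 X
      comm₁₂ := by
        refine ModuleCat.hom_ext (LinearMap.ext fun x => ?_)
        refine (Submodule.Quotient.eq N).2 ⟨-x, ?_⟩
        simp only [r, LinearMap.prod_apply, map_neg]
        exact Prod.ext (by simp; rfl) (by simp; rfl)
      comm₂₃ := rfl }
  rw [← hy]
  exact (Ext.mk₀_id_comp _).symm.trans (ShortComplex.ShortExact.extClass_naturality hT hS φ).symm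

theorem gradeGE_of_linearEquiv {i : ℕ} {N N' : ModuleCat.{u} Rᵐᵒᵖ} (e : N ≃ₗ[Rᵐᵒᵖ] N')
    (h : GradeGE i N) : GradeGE i N' := by
  intro j hj
  have := h j hj
  refine subsingleton_of_forall_eq 0 fun x => ?_
  have hid : 𝟙 N' = ModuleCat.ofHom e.symm.toLinearMap ≫ ModuleCat.ofHom e.toLinearMap := by
    ext
    simp
  rw [← Ext.mk₀_id_comp x, hid, ← Ext.mk₀_comp_mk₀_assoc, Subsingleton.elim ((Ext.mk₀ _).comp x _) 0,
    Ext.comp_zero]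

end Realization

/-! ### The cover by a W-module and the approximation. -/

section Approximation

variable {Λ : Type u} [Ring Λ]

/-- A finitely generated torsionless module embeds in a finite free module through which all
functionals factor. -/
theorem exists_dual_embedding [IsNoetherianRing Λᵐᵒᵖ] (X : ModuleCat.{u} Λ) [Module.Finite Λ X] (hX : IsTorsionless X) :
    ∃ (m : ℕ) (j : X →ₗ[Λ] (Fin m → Λ)), Function.Injective j ∧
      ∀ φ : X →ₗ[Λ] Λ, ∃ w, dotRight w ∘ₗ j = φ := by
  have := finite_dual X
  obtain ⟨m, g, hg⟩ := exists_surjective_pi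
    (opLinearEquiv Λᵐᵒᵖ : Λ ≃ₗ[Λᵐᵒᵖ] Λᵐᵒᵖ).symm (X →ₗ[Λ] Λ)
  let j : X →ₗ[Λ] (Fin m → Λ) := LinearMap.pi fun i => g (Pi.single i 1)
  have hj : ∀ φ : X →ₗ[Λ] Λ, ∃ w, dotRight w ∘ₗ j = φ := by
    intro φ
    obtain ⟨w, rfl⟩ := hg φ
    refine ⟨w, LinearMap.ext fun x => ?_⟩
    rw [map_eq_sum_op_smul, LinearMap.sum_apply]
    rfl
  refine ⟨m, j, ?_, hj⟩
  rw [injective_iff_map_eq_zero]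
  intro x hx
  refine (injective_iff_map_eq_zero _).1 hX x (LinearMap.ext fun φ => ?_)
  obtain ⟨w, rfl⟩ := hj φ
  change dotRight w (j x) = 0
  rw [hx, map_zero]

theorem addClosure_of {D : ObjectProperty (ModuleCat.{u} Λ)} {F : ModuleCat.{u} Λ} (h : D F) :
    addClosure D F :=
  ⟨ModuleCat.of Λ PUnit.{u + 1}, 1, fun _ => F, fun _ => h,
    ⟨(LinearEquiv.prodUnique (R := Λ) (M := F) (M₂ := PUnit.{u + 1})).trans
      (LinearEquiv.funUnique (Fin 1) Λ F).symm⟩⟩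

/-- A member of `addClosure D` is a retract of a finite product of members of `D`: factor each
component, then retract. -/
theorem isLeftApproximation_of_forall {D : ObjectProperty (ModuleCat.{u} Λ)}
    {M F : ModuleCat.{u} Λ} (f : M ⟶ F) (hF : D F)
    (h : ∀ Y : ModuleCat.{u} Λ, D Y → ∀ g : M →ₗ[Λ] Y, ∃ g' : F →ₗ[Λ] Y, g' ∘ₗ f.hom = g) :
    IsLeftApproximation D f := by
  refine ⟨addClosure_of hF, ?_⟩
  rintro X ⟨Z, n, Y, hY, ⟨e⟩⟩ g
  choose g' hg' using fun i => h (Y i) (hY i)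
    (LinearMap.proj i ∘ₗ e.toLinearMap ∘ₗ LinearMap.inl Λ X Z ∘ₗ g.hom)
  refine ⟨ModuleCat.ofHom
    (LinearMap.fst Λ X Z ∘ₗ e.symm.toLinearMap ∘ₗ LinearMap.pi g'), ?_⟩
  refine ModuleCat.hom_ext (LinearMap.ext fun x => ?_)
  have : (fun i => g' i (f.hom x)) = e (g.hom x, 0) := funext fun i => congr($(hg' i) x)
  change (e.symm (fun i => g' i (f.hom x))).1 = g.hom x
  rw [this, LinearEquiv.symm_apply_apply]

variable [IsNoetherianRing Λ] [IsNoetherianRing Λᵐᵒᵖ]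

/-- Under the grade conditions, `M` is a quotient of a finitely generated `Wⁿ`-module by a
submodule of projective dimension less than `n`. -/
theorem exists_isWModule_cover (M : ModuleCat.{u} Λ) [Module.Finite Λ M] (n : ℕ)
    (hG : ∀ t, 1 ≤ t → t < n → GradeGE t (ModuleCat.of Λᵐᵒᵖ (ExtRing M (t + 1)))) :
    ∃ (X : ModuleCat.{u} Λ) (p : X →ₗ[Λ] M), Function.Surjective p ∧ Module.Finite Λ X ∧
      HasProjectiveDimensionLT (ModuleCat.of Λ (LinearMap.ker p)) n ∧ IsWModule n X := by
  induction n with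
  | zero =>
    refine ⟨M, LinearMap.id, Function.surjective_id, inferInstance, ?_, fun i h₁ h₂ => by lia⟩
    refine Limits.IsZero.hasProjectiveDimensionLT_zero ?_
    have : Subsingleton (LinearMap.ker (LinearMap.id : M →ₗ[Λ] M)) := by
      rw [LinearMap.ker_id]
      infer_instance
    exact ModuleCat.isZero_of_subsingleton _
  | succ n ih =>
    obtain ⟨X, p, hp, hX, hpd, hW⟩ := ih fun t h₁ h₂ => hG t h₁ (by lia)
    have hT := LinearMap.shortExact_shortComplexKer hp
    -- The kernel has no Ext into Λ in degrees n and n + 1, so for n ≥ 1 the grade passes from M to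
    -- X; for n = 0 it is vacuous.
    have hGX : GradeGE n (ModuleCat.of Λᵐᵒᵖ (ExtRing X (n + 1))) := by
      rcases n with _ | n
      · exact fun j hj => by lia
      · refine gradeGE_of_linearEquiv (LinearEquiv.ofBijective
          (extRingComp (Ext.mk₀ (ModuleCat.ofHom p)) (zero_add _)) ⟨?_, fun x => ?_⟩)
          (hG (n + 1) (by lia) (by lia))
        · rw [injective_iff_map_eq_zero]
          intro x hx
          obtain ⟨y, hy⟩ := Ext.contravariant_sequence_exact₃ hT _ x hx (add_comm 1 (n + 1))
          refine hy.symm.trans ?_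
          rw [Ext.eq_zero_of_hasProjectiveDimensionLT y (n + 1) le_rfl, Ext.comp_zero]
          rfl
        · exact Ext.contravariant_sequence_exact₂ hT _ x
            (Ext.eq_zero_of_hasProjectiveDimensionLT _ (n + 1) (by lia))
    obtain ⟨Q, ξ, hQ, hQpd, hQvan, hsurj, hinj⟩ := exists_class_of_gradeGE X n hW hGX
    obtain ⟨E, i, q, w, hS, hE, rfl⟩ := exists_shortExact_extClass_eq X Q ξ
    have hq : Function.Surjective q.hom := hS.moduleCat_surjective_g
    refine ⟨E, p ∘ₗ q.hom, hp.comp hq, hE, ?_, fun l h₁ h₂ => ?_⟩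
    -- The new kernel is an extension of the old kernel by Q.
    · have hiq : ∀ z, q.hom (i.hom z) = 0 := fun z => congr($w z)
      let i' : Q →ₗ[Λ] LinearMap.ker (p ∘ₗ q.hom) := i.hom.codRestrict _ fun z => by
        simp [hiq]
      let q' : LinearMap.ker (p ∘ₗ q.hom) →ₗ[Λ] LinearMap.ker p :=
        q.hom.restrict fun x hx => hx
      have hi' : Function.Injective i' := fun a b hab =>
        hS.moduleCat_injective_f congr(($hab).1)
      have hq' : Function.Surjective q' := fun x => by
        obtain ⟨e, he⟩ := hq x.1
        exact ⟨⟨e, (congrArg p he).trans x.2⟩, Subtype.ext he⟩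
      have hex : Function.Exact i' q' := by
        intro x
        constructor
        · intro hx
          obtain ⟨z, hz⟩ := ((ShortComplex.ShortExact.moduleCat_exact_iff_function_exact _).1
            hS.exact x.1).1 congr(($hx).1)
          exact ⟨z, Subtype.ext hz⟩
        · rintro ⟨z, rfl⟩
          exact Subtype.ext (hiq z)
      exact (shortExact_of_exact hi' hex hq').hasProjectiveDimensionLT_X₂ (n + 1) hQpd
        (hasProjectiveDimensionLT_of_ge _ n _ (by lia))
    · refine subsingleton_of_forall_eq (α := Ext.{u} E (ModuleCat.of Λ Λ) l) 0 fun x => ?_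
      -- The restriction to Q vanishes: below n by the choice of Q, at n because multiplication by
      -- the class is injective, above n by projective dimension.
      have hx : (Ext.mk₀ i).comp x (zero_add l) = 0 := by
        rcases lt_trichotomy l n with h | rfl | h
        · have := hQvan l h₁ h
          exact Subsingleton.elim _ _
        · exact hinj h₁ _ (hS.extClass_comp_assoc x)
        · have : HasProjectiveDimensionLT Q (n + 1) := hQpd
          exact Ext.eq_zero_of_hasProjectiveDimensionLT _ (n + 1) (by lia)
      -- So the class is pulled back from X. In degree n + 1 it is a multiple of the extension
      -- class, which dies on E; in lower degrees X has none.
      obtain ⟨y, rfl⟩ := Ext.contravariant_sequence_exact₂ hS _ x hx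
      rcases Nat.lt_or_ge n l with h | h
      · obtain rfl : l = n + 1 := by lia
        obtain ⟨z, rfl⟩ := hsurj y
        exact hS.comp_extClass_assoc z _
      · have : Subsingleton (Ext.{u} X (ModuleCat.of Λ Λ) l) := hW l h₁ h
        rw [Subsingleton.elim y 0, Ext.comp_zero]

theorem hasLeftApproximation_of_gradeGE (k : ℕ) (M : ModuleCat.{u} Λ)
    [Module.Finite Λ M]
    (hG : ∀ t, 1 ≤ t → t < k → GradeGE t (ModuleCat.of Λᵐᵒᵖ (ExtRing M (t + 1))))
    (hW : HasPropertyW Λ k) : HasLeftApproximation (projDimLE Λ k) M := by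
  obtain ⟨X, p, hp, hX, hpd, hWX⟩ := exists_isWModule_cover M k hG
  obtain ⟨m, j, hj, hjext⟩ := exists_dual_embedding X (hW X hX hWX)
  have hS := shortExact_of_exact hj (LinearMap.exact_map_mkQ_range j) (Submodule.mkQ_surjective _)
  have hproj : Projective (ModuleCat.of Λ (Fin m → Λ)) := inferInstance
  have hY : ∀ l, 1 ≤ l → l < 1 + (k + 1) → Subsingleton (Ext.{u}
      (ModuleCat.of Λ ((Fin m → Λ) ⧸ LinearMap.range j)) (ModuleCat.of Λ Λ) l) := by
    intro l h₁ h₂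
    obtain ⟨l, rfl⟩ : ∃ t, l = t + 1 := ⟨l - 1, by lia⟩
    have := Ext.subsingleton_of_projective (ModuleCat.of Λ (Fin m → Λ)) (ModuleCat.of Λ Λ) l
    rcases l with _ | l
    · refine subsingleton_ext_one_of_extension hS fun φ => ?_
      obtain ⟨w, hw⟩ := hjext φ.hom
      exact ⟨ModuleCat.ofHom (dotRight w), ModuleCat.hom_ext hw⟩
    · have : Subsingleton (Ext.{u} X (ModuleCat.of Λ Λ) (l + 1)) := hWX _ (by lia) (by lia)
      exact subsingleton_ext_X₃ hS _ _
  -- The quotient Λᵐ/K is the pushout of `j` along `p`; its projective dimension exceeds that of K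
  -- by at most one.
  let i : LinearMap.ker p →ₗ[Λ] (Fin m → Λ) := j ∘ₗ (LinearMap.ker p).subtype
  have hF := shortExact_of_exact (hj.comp (Submodule.injective_subtype _) : Function.Injective i)
    (LinearMap.exact_map_mkQ_range i) (Submodule.mkQ_surjective _)
  have hFpd : HasProjectiveDimensionLT (ModuleCat.of Λ ((Fin m → Λ) ⧸ LinearMap.range i))
      (k + 1) := hF.hasProjectiveDimensionLT_X₃ k hpd
    (hasProjectiveDimensionLT_of_ge _ 1 _ (by lia))
  obtain ⟨f, hf⟩ := exists_comp_eq_of_ker_le hp ((LinearMap.range i).mkQ ∘ₗ j) (by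
    intro x hx
    exact (Submodule.Quotient.mk_eq_zero _).2 ⟨⟨x, hx⟩, rfl⟩)
  refine ⟨ModuleCat.of Λ ((Fin m → Λ) ⧸ LinearMap.range i), ModuleCat.ofHom f,
    isLeftApproximation_of_forall _
      ⟨inferInstanceAs (Module.Finite Λ ((Fin m → Λ) ⧸ LinearMap.range i)), hFpd⟩ ?_⟩
  rintro Y ⟨hYfin, hYpd⟩ g
  have hYpd' : HasProjectiveDimensionLT Y (k + 1) := hYpd
  obtain ⟨h, hh⟩ := exists_extension_of_ext_one hS
    (subsingleton_ext_of_hasProjectiveDimensionLT _ (k + 1) 1 Y hY) (ModuleCat.ofHom (g ∘ₗ p))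
  have hh' : ∀ x, h.hom (j x) = g (p x) := fun x => congr($hh x)
  have hle : LinearMap.range i ≤ LinearMap.ker h.hom := by
    rintro _ ⟨x, rfl⟩
    refine (hh' x.1).trans ?_
    rw [LinearMap.mem_ker.1 x.2, map_zero]
  refine ⟨(LinearMap.range i).liftQ h.hom hle, LinearMap.ext fun y => ?_⟩
  obtain ⟨x, rfl⟩ := hp y
  have : f (p x) = (LinearMap.range i).mkQ (j x) := congr($hf x)
  change (LinearMap.range i).liftQ h.hom hle (f (p x)) = g (p x)
  rw [this]
  exact hh' x

end Approximation

/-! ### Exactness of the tensor product over Λ. -/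

section Tensor

variable {Λ : Type u} [Ring Λ]

theorem tensorMap_mk (N : ModuleCat.{u} Λᵐᵒᵖ) {M M' : ModuleCat.{u} Λ} (f : M →ₗ[Λ] M')
    (x : N ⊗[ℤ] M) : tensorMap N f (QuotientAddGroup.mk x) =
      QuotientAddGroup.mk (LinearMap.lTensor N (f.restrictScalars ℤ) x) := rfl

theorem tensorMap_comp (N : ModuleCat.{u} Λᵐᵒᵖ) {A B C : ModuleCat.{u} Λ} (f : A →ₗ[Λ] B)
    (g : B →ₗ[Λ] C) (x : (N ⊗[ℤ] A) ⧸ tensorRel N A) :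
    tensorMap N (g ∘ₗ f) x = tensorMap N g (tensorMap N f x) := by
  obtain ⟨x, rfl⟩ := QuotientAddGroup.mk_surjective x
  rw [tensorMap_mk, tensorMap_mk, tensorMap_mk, ← LinearMap.comp_apply, ← LinearMap.lTensor_comp]
  rfl

/-- The tensor product is right exact. -/
theorem exists_tensorMap_eq (N : ModuleCat.{u} Λᵐᵒᵖ) {A B C : ModuleCat.{u} Λ} {f : A →ₗ[Λ] B}
    {g : B →ₗ[Λ] C} (hfg : Function.Exact f g) (hg : Function.Surjective g)
    (x : (N ⊗[ℤ] B) ⧸ tensorRel N B) (hx : tensorMap N g x = 0) :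
    ∃ y, tensorMap N f y = x := by
  obtain ⟨x, rfl⟩ := QuotientAddGroup.mk_surjective x
  -- As `g` is onto, relations over C lift to relations over B, reducing the claim to right
  -- exactness over ℤ.
  have hle : tensorRel N C ≤ (tensorRel N B).map
      (LinearMap.lTensor N (g.restrictScalars ℤ)).toAddMonoidHom := by
    refine (AddSubgroup.closure_le _).2 ?_
    rintro _ ⟨n, r, c, rfl⟩
    obtain ⟨b, rfl⟩ := hg c
    refine ⟨_, AddSubgroup.subset_closure ⟨n, r, b, rfl⟩, ?_⟩
    simp
  obtain ⟨z, hz, hzx⟩ := hle ((QuotientAddGroup.eq_zero_iff _).1 hx)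
  have hex : Function.Exact (f.restrictScalars ℤ) (g.restrictScalars ℤ) := hfg
  obtain ⟨y, hy⟩ := (lTensor_exact N hex hg (x - z)).1 (by
    rw [map_sub, sub_eq_zero]
    exact hzx.symm)
  refine ⟨QuotientAddGroup.mk y, ?_⟩
  rw [tensorMap_mk, hy, QuotientAddGroup.mk_sub, (QuotientAddGroup.eq_zero_iff z).2 hz, sub_zero]

/-- Right exactness handles B → im g, and flatness keeps N ⊗ im g → N ⊗ C injective. -/
theorem IsFlatRight.exists_tensorMap_eq {N : ModuleCat.{u} Λᵐᵒᵖ} (hN : IsFlatRight N)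
    {A B C : ModuleCat.{u} Λ} {f : A →ₗ[Λ] B} {g : B →ₗ[Λ] C} (hfg : Function.Exact f g)
    (x : (N ⊗[ℤ] B) ⧸ tensorRel N B) (hx : tensorMap N g x = 0) :
    ∃ y, tensorMap N f y = x := by
  have hex : Function.Exact f g.rangeRestrict := by
    rw [LinearMap.exact_iff, LinearMap.ker_rangeRestrict]
    exact LinearMap.exact_iff.1 hfg
  refine HomologicalFiniteness.exists_tensorMap_eq N (C := ModuleCat.of Λ (LinearMap.range g)) hex
    (LinearMap.surjective_rangeRestrict g) x ?_
  refine (injective_iff_map_eq_zero _).1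
    (hN (ModuleCat.of Λ (LinearMap.range g)) C (LinearMap.range g).subtype
      (Submodule.injective_subtype _)) _ ?_
  rw [← tensorMap_comp]
  exact hx

end Tensor

/-! ### Duals of free modules, N ⊗ P ≅ Hom(P*, N), and vanishing of Tor. -/

section Dual

variable {Λ : Type u} [Ring Λ]

/-- The map of right modules `Q* → P*` induced by `f : P → Q`. -/
def dualMap {P Q : Type u} [AddCommGroup P] [AddCommGroup Q] [Module Λ P] [Module Λ Q]
    (f : P →ₗ[Λ] Q) : (Q →ₗ[Λ] Λ) →ₗ[Λᵐᵒᵖ] (P →ₗ[Λ] Λ) where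
  toFun φ := φ ∘ₗ f
  map_add' _ _ := rfl
  map_smul' _ _ := rfl

@[simp]
theorem dualMap_apply {P Q : Type u} [AddCommGroup P] [AddCommGroup Q] [Module Λ P] [Module Λ Q]
    (f : P →ₗ[Λ] Q) (φ : Q →ₗ[Λ] Λ) : dualMap f φ = φ ∘ₗ f := rfl

theorem sum_op_smul_proj {m : ℕ} (φ : (Fin m → Λ) →ₗ[Λ] Λ) :
    ∑ i, op (φ (Pi.single i 1)) • (LinearMap.proj i : (Fin m → Λ) →ₗ[Λ] Λ) = φ := by
  refine LinearMap.ext fun v => ?_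
  rw [map_eq_sum_smul φ, LinearMap.sum_apply]
  rfl

instance projective_dual_pi (m : ℕ) : Module.Projective Λᵐᵒᵖ ((Fin m → Λ) →ₗ[Λ] Λ) := by
  let g : ((Fin m → Λ) →ₗ[Λ] Λ) →ₗ[Λᵐᵒᵖ] (Fin m → Λ) :=
    { toFun := fun φ i => φ (Pi.single i 1)
      map_add' := fun _ _ => rfl
      map_smul' := fun _ _ => rfl }
  have hg : Function.Bijective g := by
    refine ⟨fun φ ψ h => ?_, fun w => ⟨dotRight w, funext fun i => ?_⟩⟩
    · rw [← sum_op_smul_proj φ, ← sum_op_smul_proj ψ]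
      exact Finset.sum_congr rfl fun i _ => by
        have hi : φ (Pi.single i 1) = ψ (Pi.single i 1) := congrFun h i
        rw [hi]
    · exact single_one_dotProduct i w
  exact Module.Projective.of_equiv ((LinearEquiv.ofBijective g hg).trans
    (LinearEquiv.piCongrRight fun _ : Fin m => (opLinearEquiv Λᵐᵒᵖ : Λ ≃ₗ[Λᵐᵒᵖ] Λᵐᵒᵖ))).symm

/-- The canonical map `N ⊗ P → Hom(P*, N)`. -/
def tensorToHom (N : ModuleCat.{u} Λᵐᵒᵖ) (P : ModuleCat.{u} Λ) :
    ((N ⊗[ℤ] P) ⧸ tensorRel N P) →+ ((P →ₗ[Λ] Λ) →ₗ[Λᵐᵒᵖ] N) :=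
  QuotientAddGroup.lift _ (TensorProduct.liftAddHom
    (AddMonoidHom.mk' (fun n => AddMonoidHom.mk' (fun x =>
        { toFun := fun φ => op (φ x) • n
          map_add' := fun φ ψ => by simp [add_smul]
          map_smul' := fun r φ => by
            change op (φ x * r.unop) • n = r • op (φ x) • n
            rw [op_mul, mul_smul, op_unop] } : P → ((P →ₗ[Λ] Λ) →ₗ[Λᵐᵒᵖ] N))
        (fun x y => LinearMap.ext fun φ => by simp [add_smul]))
      (fun n n' => AddMonoidHom.ext fun x => LinearMap.ext fun φ => smul_add (op (φ x)) n n'))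
    (fun z n x => LinearMap.ext fun φ => by
      change op (φ x) • (z • n) = op (φ (z • x)) • n
      rw [map_zsmul, op_smul, smul_comm, smul_assoc])) (by
    refine (AddSubgroup.closure_le _).2 ?_
    rintro _ ⟨n, r, x, rfl⟩
    rw [SetLike.mem_coe, AddMonoidHom.mem_ker, map_sub]
    refine LinearMap.ext fun φ => ?_
    change op (φ x) • op r • n - op (φ (r • x)) • n = 0
    rw [map_smul, smul_eq_mul, op_mul, mul_smul, sub_self])

theorem tensorToHom_tensorMap (N : ModuleCat.{u} Λᵐᵒᵖ) {P Q : ModuleCat.{u} Λ} (f : P →ₗ[Λ] Q)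
    (x : (N ⊗[ℤ] P) ⧸ tensorRel N P) :
    tensorToHom N Q (tensorMap N f x) = tensorToHom N P x ∘ₗ dualMap f := by
  obtain ⟨x, rfl⟩ := QuotientAddGroup.mk_surjective x
  induction x using TensorProduct.induction_on with
  | zero => simp
  | tmul n y => rfl
  | add a b ha hb =>
    rw [QuotientAddGroup.mk_add, map_add, map_add, ha, hb, map_add, LinearMap.add_comp]

theorem tensorToHom_surjective (N : ModuleCat.{u} Λᵐᵒᵖ) (m : ℕ) :
    Function.Surjective (tensorToHom N (ModuleCat.of Λ (Fin m → Λ))) := by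
  intro v
  refine ⟨∑ i, QuotientAddGroup.mk (v (LinearMap.proj i) ⊗ₜ[ℤ] (Pi.single i 1 : Fin m → Λ)), ?_⟩
  refine LinearMap.ext fun φ => ?_
  conv_rhs => rw [← sum_op_smul_proj φ]
  rw [map_sum, LinearMap.sum_apply, map_sum]
  refine Finset.sum_congr rfl fun i _ => ?_
  rw [map_smul]
  rfl

theorem tensorToHom_injective (N : ModuleCat.{u} Λᵐᵒᵖ) (m : ℕ) :
    Function.Injective (tensorToHom N (ModuleCat.of Λ (Fin m → Λ))) := by
  have key : ∀ x : (N ⊗[ℤ] ModuleCat.of Λ (Fin m → Λ)) ⧸ tensorRel N (ModuleCat.of Λ (Fin m → Λ)),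
      x = ∑ i, QuotientAddGroup.mk (tensorToHom N (ModuleCat.of Λ (Fin m → Λ)) x
        (LinearMap.proj i) ⊗ₜ[ℤ] (Pi.single i 1 : Fin m → Λ)) := by
    intro x
    obtain ⟨x, rfl⟩ := QuotientAddGroup.mk_surjective x
    induction x using TensorProduct.induction_on with
    | zero => simp
    | tmul n y =>
      have : n ⊗ₜ[ℤ] y = ∑ i, n ⊗ₜ[ℤ] (y i • (Pi.single i 1 : Fin m → Λ)) := by
        rw [← TensorProduct.tmul_sum]
        exact congrArg _ (sum_smul_single y).symm
      conv_lhs => rw [this, ← QuotientAddGroup.mk'_apply, map_sum]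
      refine Finset.sum_congr rfl fun i _ => ?_
      refine Eq.symm ((QuotientAddGroup.eq_iff_sub_mem).2 ?_)
      exact AddSubgroup.subset_closure ⟨n, y i, Pi.single i 1, rfl⟩
    | add a b ha hb =>
      rw [QuotientAddGroup.mk_add, map_add]
      conv_lhs => rw [ha, hb]
      rw [← Finset.sum_add_distrib]
      refine Finset.sum_congr rfl fun i _ => ?_
      rw [LinearMap.add_apply, TensorProduct.add_tmul, QuotientAddGroup.mk_add]
  intro x y h
  rw [key x, key y, h]

/-- Vanishing of `Tor` in degrees above the flat dimension, in terms of `Hom(P*, N)` for a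
resolution `P` by finite free modules. -/
theorem exists_comp_dualMap_eq {m : ℕ → ℕ} (d : ∀ i, (Fin (m (i + 1)) → Λ) →ₗ[Λ] (Fin (m i) → Λ))
    (hd : ∀ i, Function.Exact (d (i + 1)) (d i)) (n : ℕ) :
    ∀ (N : ModuleCat.{u} Λᵐᵒᵖ), FlatDimLE n N → ∀ i, n ≤ i →
      ∀ v : ((Fin (m (i + 1)) → Λ) →ₗ[Λ] Λ) →ₗ[Λᵐᵒᵖ] N, v ∘ₗ dualMap (d i) = 0 →
        ∃ w : ((Fin (m (i + 2)) → Λ) →ₗ[Λ] Λ) →ₗ[Λᵐᵒᵖ] N, w ∘ₗ dualMap (d (i + 1)) = v := by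
  have flat : ∀ (N : ModuleCat.{u} Λᵐᵒᵖ), IsFlatRight N → ∀ i,
      ∀ v : ((Fin (m (i + 1)) → Λ) →ₗ[Λ] Λ) →ₗ[Λᵐᵒᵖ] N, v ∘ₗ dualMap (d i) = 0 →
        ∃ w : ((Fin (m (i + 2)) → Λ) →ₗ[Λ] Λ) →ₗ[Λᵐᵒᵖ] N, w ∘ₗ dualMap (d (i + 1)) = v := by
    intro N hN i v hv
    obtain ⟨x, rfl⟩ := tensorToHom_surjective N (m (i + 1)) v
    obtain ⟨y, rfl⟩ := hN.exists_tensorMap_eq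
      (A := ModuleCat.of Λ (Fin (m (i + 2)) → Λ)) (B := ModuleCat.of Λ (Fin (m (i + 1)) → Λ))
      (C := ModuleCat.of Λ (Fin (m i) → Λ)) (hd i) x (by
        refine tensorToHom_injective N (m i) ?_
        rw [map_zero]
        exact (tensorToHom_tensorMap N (P := ModuleCat.of Λ (Fin (m (i + 1)) → Λ))
          (Q := ModuleCat.of Λ (Fin (m i) → Λ)) (d i) x).trans hv)
    exact ⟨tensorToHom N (ModuleCat.of Λ (Fin (m (i + 2)) → Λ)) y,
      (tensorToHom_tensorMap N (P := ModuleCat.of Λ (Fin (m (i + 2)) → Λ))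
        (Q := ModuleCat.of Λ (Fin (m (i + 1)) → Λ)) (d (i + 1)) y).symm⟩
  have hdd : ∀ i φ, dualMap (d (i + 1)) (dualMap (d i) φ) = 0 := fun i φ => by
    rw [dualMap_apply, dualMap_apply, LinearMap.comp_assoc, (hd i).linearMap_comp_eq_zero,
      LinearMap.comp_zero]
  induction n with
  | zero => exact fun N hN i _ => flat N hN i
  | succ n ih =>
    rintro N ⟨K, F, ι, p, hι, hex, hp, hF, hK⟩ i hi v hv
    obtain ⟨i, rfl⟩ : ∃ t, i = t + 1 := ⟨i - 1, by lia⟩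
    -- Lift the cocycle to F. The failure of the lift to be a cocycle is a cocycle `u` in K one
    -- degree lower; induction bounds it by `w₁`, and subtracting `w₁` gives a cocycle in the flat
    -- module F.
    obtain ⟨v', hv'⟩ := Module.projective_lifting_property p v hp
    have hmem : ∀ φ, v' (dualMap (d (i + 1)) φ) ∈ LinearMap.range ι := fun φ => by
      rw [← LinearMap.exact_iff.1 hex, LinearMap.mem_ker, ← LinearMap.comp_apply, hv']
      exact congr($hv φ)
    let e := LinearEquiv.ofInjective ι hι
    let u : ((Fin (m (i + 1)) → Λ) →ₗ[Λ] Λ) →ₗ[Λᵐᵒᵖ] K :=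
      e.symm.toLinearMap ∘ₗ (v' ∘ₗ dualMap (d (i + 1))).codRestrict (LinearMap.range ι) hmem
    have hu : ∀ φ, ι (u φ) = v' (dualMap (d (i + 1)) φ) := fun φ =>
      congrArg Subtype.val (e.apply_symm_apply ⟨_, hmem φ⟩)
    obtain ⟨w₁, hw₁⟩ := ih K hK i (by lia) u (LinearMap.ext fun φ => hι (by
      rw [LinearMap.comp_apply, hu, hdd, map_zero, LinearMap.zero_apply, map_zero]))
    obtain ⟨w, hw⟩ := flat F hF (i + 1) (v' - ι ∘ₗ w₁) (LinearMap.ext fun φ => by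
      have : w₁ (dualMap (d (i + 1)) φ) = u φ := congr($hw₁ φ)
      rw [LinearMap.comp_apply, LinearMap.sub_apply, LinearMap.comp_apply, this, hu, sub_self,
        LinearMap.zero_apply])
    refine ⟨p ∘ₗ w, ?_⟩
    rw [LinearMap.comp_assoc, hw, LinearMap.comp_sub, hv', ← LinearMap.comp_assoc,
      hex.linearMap_comp_eq_zero, LinearMap.zero_comp, sub_zero]

end Dual

/-! ### Grade from flat dimension over quasi-Gorenstein rings. -/

section Grade

variable {Λ : Type u} [Ring Λ]

theorem extRingComp_extClass_comp {S : ShortComplex (ModuleCat.{u} Λ)} (hS : S.ShortExact)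
    (ψ : S.X₂ →ₗ[Λ] Λ) :
    extRingComp hS.extClass (add_zero 1) (homToExtRing S.X₁ (ψ ∘ₗ S.f.hom)) = 0 := by
  have h : homToExtRing S.X₁ (ψ ∘ₗ S.f.hom) =
      (Ext.mk₀ S.f).comp (Ext.mk₀ (ModuleCat.ofHom ψ)) (zero_add 0) :=
    (Ext.mk₀_comp_mk₀ S.f (ModuleCat.ofHom ψ)).symm
  rw [h]
  exact hS.extClass_comp_assoc (h := add_zero 1) _

/-- Homomorphisms from `Extⁱ⁺¹(X, Λ)` to an injective right module `I` vanish if the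
`(i + 1)`-st homology of `Hom(P*, I)` does. -/
theorem extRing_hom_eq_zero (I : ModuleCat.{u} Λᵐᵒᵖ) [Injective I] (i : ℕ) :
    ∀ (X : Type u) [AddCommGroup X] [Module Λ X] (P : ℕ → Type u) [∀ i, AddCommGroup (P i)]
      [∀ i, Module Λ (P i)] [∀ i, Module.Projective Λ (P i)] (d : ∀ i, P (i + 1) →ₗ[Λ] P i)
      (p : P 0 →ₗ[Λ] X), Function.Surjective p → Function.Exact (d 0) p →
      (∀ i, Function.Exact (d (i + 1)) (d i)) →
      (∀ v : (P (i + 1) →ₗ[Λ] Λ) →ₗ[Λᵐᵒᵖ] I, v ∘ₗ dualMap (d i) = 0 →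
        ∃ w : (P (i + 2) →ₗ[Λ] Λ) →ₗ[Λᵐᵒᵖ] I, w ∘ₗ dualMap (d (i + 1)) = v) →
      ∀ h : ExtRing (ModuleCat.of Λ X) (i + 1) →ₗ[Λᵐᵒᵖ] I, h = 0 := by
  induction i with
  | zero =>
    intro X _ _ P _ _ _ d p hp h₀ hd hv h
    have hex : Function.Exact (LinearMap.range (d 0)).subtype p := by
      rw [LinearMap.exact_iff, Submodule.range_subtype, LinearMap.exact_iff.1 h₀]
    have hS := shortExact_of_exact (Submodule.injective_subtype _) hex hp
    have hproj : Projective (ModuleCat.of Λ (P 0)) := inferInstance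
    let K := ModuleCat.of Λ (LinearMap.range (d 0))
    let q : P 1 →ₗ[Λ] K := (d 0).rangeRestrict
    have hq : Function.Surjective q := LinearMap.surjective_rangeRestrict (d 0)
    let δ : (K →ₗ[Λ] Λ) →ₗ[Λᵐᵒᵖ] ExtRing (ModuleCat.of Λ X) 1 :=
      extRingComp hS.extClass (add_zero 1) ∘ₗ homToExtRing K
    have hδ : Function.Surjective δ := fun x => by
      obtain ⟨y, hy⟩ := Ext.contravariant_sequence_exact₃ hS (ModuleCat.of Λ Λ) x
        (Ext.eq_zero_of_projective _) (add_zero 1)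
      obtain ⟨φ, rfl⟩ := homToExtRing_surjective K y
      exact ⟨φ, hy⟩
    have hmono : Mono (ModuleCat.ofHom (dualMap q)) := by
      rw [ModuleCat.mono_iff_injective]
      intro φ ψ hφψ
      refine LinearMap.ext fun x => ?_
      obtain ⟨y, rfl⟩ := hq x
      exact congr($hφψ y)
    -- Injectivity of I extends `h ∘ₗ δ` from K* to (P 1)*. The result kills functionals coming from
    -- `P 0`, so it factors through restriction along `d 1`; that restriction kills K*, whence `h =
    -- 0`.
    let v := (Injective.factorThru (ModuleCat.ofHom (h ∘ₗ δ)) (ModuleCat.ofHom (dualMap q))).hom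
    have hvq : ∀ φ, v (φ ∘ₗ q) = h (δ φ) := fun φ =>
      congr($(Injective.comp_factorThru (ModuleCat.ofHom (h ∘ₗ δ))
        (ModuleCat.ofHom (dualMap q))) φ)
    obtain ⟨w, hw⟩ := hv v (LinearMap.ext fun ψ => by
      have hψ : δ (ψ ∘ₗ (LinearMap.range (d 0)).subtype) = 0 :=
        extRingComp_extClass_comp hS ψ
      have := hvq (ψ ∘ₗ (LinearMap.range (d 0)).subtype)
      rw [hψ, map_zero] at this
      exact this)
    refine LinearMap.ext fun x => ?_
    obtain ⟨φ, rfl⟩ := hδ x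
    rw [← hvq, ← hw, LinearMap.comp_apply, dualMap_apply]
    have : (φ ∘ₗ q) ∘ₗ d 1 = 0 := LinearMap.ext fun y => by
      have : q (d 1 y) = 0 := Subtype.ext ((hd 0).apply_apply_eq_zero y)
      simp [this]
    rw [this, map_zero, LinearMap.zero_apply]
  | succ i ih =>
    intro X _ _ P _ _ _ d p hp h₀ hd hv h
    have hex : Function.Exact (LinearMap.range (d 0)).subtype p := by
      rw [LinearMap.exact_iff, Submodule.range_subtype, LinearMap.exact_iff.1 h₀]
    have hS := shortExact_of_exact (Submodule.injective_subtype _) hex hp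
    have hproj : Projective (ModuleCat.of Λ (P 0)) := inferInstance
    have hex' : Function.Exact (d 1) (d 0).rangeRestrict := by
      rw [LinearMap.exact_iff, LinearMap.ker_rangeRestrict]
      exact LinearMap.exact_iff.1 (hd 0)
    let δ : ExtRing (ModuleCat.of Λ (LinearMap.range (d 0))) (i + 1) →ₗ[Λᵐᵒᵖ]
        ExtRing (ModuleCat.of Λ X) (i + 1 + 1) := extRingComp hS.extClass (add_comm 1 (i + 1))
    have hz := ih (LinearMap.range (d 0)) (fun i => P (i + 1)) (fun i => d (i + 1))
      (d 0).rangeRestrict (LinearMap.surjective_rangeRestrict _) hex' (fun i => hd (i + 1)) hv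
      (h ∘ₗ δ)
    refine LinearMap.ext fun x => ?_
    obtain ⟨y, rfl⟩ := Ext.contravariant_sequence_exact₃ hS (ModuleCat.of Λ Λ) x
      (Ext.eq_zero_of_projective _) (add_comm 1 (i + 1))
    exact congr($hz y)

/-- Vanishing of `Hom(E, Iᵢ)` for the first terms of an injective coresolution of `L` implies
vanishing of `Extʲ(E, L)`. -/
theorem subsingleton_ext_of_injective_coresolution {R : Type u} [Ring R] (E : ModuleCat.{u} R)
    (j : ℕ) : ∀ (L : ModuleCat.{u} R) (I : ℕ → ModuleCat.{u} R) [∀ i, Injective (I i)]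
      (d : ∀ i, I i →ₗ[R] I (i + 1)) (ι : L →ₗ[R] I 0), Function.Injective ι →
      Function.Exact ι (d 0) → (∀ i, Function.Exact (d i) (d (i + 1))) →
      (∀ i ≤ j, ∀ f : E →ₗ[R] I i, f = 0) → Subsingleton (Ext.{u} E L j) := by
  induction j with
  | zero =>
    intro L I _ d ι hι h₀ hd hE
    refine subsingleton_of_forall_eq 0 fun x => ?_
    obtain ⟨f, rfl⟩ := (Ext.mk₀_bijective _ _).2 x
    rw [Ext.mk₀_eq_zero_iff]
    refine ModuleCat.hom_ext (LinearMap.ext fun x => hι ?_)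
    refine congr($(hE 0 le_rfl (ι ∘ₗ f.hom)) x).trans ?_
    exact (map_zero ι).symm
  | succ j ih =>
    intro L I _ d ι hι h₀ hd hE
    have hex : Function.Exact ι (d 0).rangeRestrict := by
      rw [LinearMap.exact_iff, LinearMap.ker_rangeRestrict]
      exact LinearMap.exact_iff.1 h₀
    have hS := shortExact_of_exact hι hex (LinearMap.surjective_rangeRestrict _)
    have : Subsingleton (Ext.{u} E (ModuleCat.of R (LinearMap.range (d 0))) j) := by
      refine ih _ (fun i => I (i + 1)) (fun i => d (i + 1)) (LinearMap.range (d 0)).subtype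
        (Submodule.injective_subtype _) ?_ (fun i => hd (i + 1)) fun i hi => hE (i + 1) (by lia)
      rw [LinearMap.exact_iff, Submodule.range_subtype]
      exact LinearMap.exact_iff.1 (hd 0)
    have := Ext.subsingleton_of_injective E (I 0) j
    exact subsingleton_ext_covariant_X₁ hS E j

/-- Over a right quasi `k`-Gorenstein ring, `Extᵗ⁺¹(M, Λ)` has grade at least `t` for
`t ≤ k`. -/
theorem IsRightQuasiGorenstein.gradeGE [IsNoetherianRing Λ] {k : ℕ}
    (hΛ : IsRightQuasiGorenstein Λ k) (M : ModuleCat.{u} Λ) [Module.Finite Λ M] (t : ℕ)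
    (ht : t ≤ k) : GradeGE t (ModuleCat.of Λᵐᵒᵖ (ExtRing M (t + 1))) := by
  obtain ⟨I, -, hI⟩ := hΛ
  obtain ⟨m, d, p, hp, h₀, hd⟩ := exists_resolution_pi (LinearEquiv.refl Λ Λ) M
  intro j hj
  have : Mono (I.ι.f 0) := inferInstance
  refine subsingleton_ext_of_injective_coresolution _ j _ (fun i => I.cocomplex.X i)
    (fun i => (I.cocomplex.d i (i + 1)).hom) (I.ι.f 0).hom ((ModuleCat.mono_iff_injective _).1 this)
    ((ShortComplex.ShortExact.moduleCat_exact_iff_function_exact _).1 I.exact₀)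
    (fun i => (ShortComplex.ShortExact.moduleCat_exact_iff_function_exact _).1 (I.exact_succ i))
    fun i hi f => ?_
  -- Since i ≤ j < t ≤ k, the term has flat dimension at most i + 1 ≤ t, below the Tor degree t + 1.
  exact extRing_hom_eq_zero (I.cocomplex.X i) t M (fun i => Fin (m i) → Λ) d p hp h₀ hd
    (exists_comp_dualMap_eq d hd (i + 1) _ (hI i (by lia)) t (by lia)) f

end Grade

end HomologicalFiniteness

end

theorem proposition3p7 (Λ : Type u) [Ring Λ] [IsNoetherianRing Λ] [IsNoetherianRing Λᵐᵒᵖ]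
    (k : ℕ) (hk : 1 ≤ k) :
    (∀ M : ModuleCat.{u} Λ, HomologicalFiniteness.finMod Λ M →
      (∀ t : ℕ, 1 ≤ t → t < k →
        HomologicalFiniteness.StrongGradeGE t
          (ModuleCat.of Λᵐᵒᵖ (HomologicalFiniteness.ExtRing M (t + 1)))) →
      HomologicalFiniteness.HasPropertyW Λ k →
      HomologicalFiniteness.HasLeftApproximation
        (HomologicalFiniteness.projDimLE Λ k) M) ∧
    (HomologicalFiniteness.IsRightQuasiGorenstein Λ k →
      (HomologicalFiniteness.HasPropertyW Λ k →
        HomologicalFiniteness.IsCovariantlyFinite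
          (HomologicalFiniteness.projDimLE Λ k) (HomologicalFiniteness.finMod Λ)) ∧
      (HomologicalFiniteness.HasPropertyW Λ (k + 1) →
        HomologicalFiniteness.IsCovariantlyFinite
          (HomologicalFiniteness.projDimLE Λ (k + 1)) (HomologicalFiniteness.finMod Λ))) := by
  refine ⟨fun M hM hG hW => ?_, fun hΛ => ⟨fun hW => ⟨fun M hM => hM.1, fun M hM => ?_⟩,
    fun hW => ⟨fun M hM => hM.1, fun M hM => ?_⟩⟩⟩
  · have : Module.Finite Λ M := hM
    exact HomologicalFiniteness.hasLeftApproximation_of_gradeGE k M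
      -- The submodule `⊤` yields the grade of Extᵗ⁺¹(M, Λ) itself.
      (fun t h₁ h₂ => HomologicalFiniteness.gradeGE_of_linearEquiv Submodule.topEquiv
        (hG t h₁ h₂ ⊤)) hW
  · have : Module.Finite Λ M := hM
    exact HomologicalFiniteness.hasLeftApproximation_of_gradeGE k M
      (fun t _ ht => hΛ.gradeGE M t (by lia)) hW
  · have : Module.Finite Λ M := hM
    -- The range t < k + 1 is t ≤ k, exactly what the quasi k-Gorenstein condition supplies.
    exact HomologicalFiniteness.hasLeftApproximation_of_gradeGE (k + 1) M
      (fun t _ ht => hΛ.gradeGE M t (by lia)) hW
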